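/- **Definitions.** Let $\mathscr Q=\{(x,y)\in\mathbb R^2: x^2+y^2=1,\ x,y\ge 0\}$ and let $$\mathcal T(x,y)=\left(\frac{|2-x-2y|}{3-2x-2y},\ \frac{|2-2x-y|}{3-2x-2y}\right)\qquad((x,y)\in\mathscr Q).$$ A digit of $(x,y)\in\mathscr Q$ is $1$ if $\frac45\le x\le 1$, $2$ if $\frac35\le x\le\frac45$, $3$ if $0\le x\le\frac35$ (the points with $x=\frac45$ and $x=\frac35$ have two digits). A sequence $d_1d_2\cdots\in\{1,2,3\}^{\mathbb N}$ is an expansion of $P\in\mathscr Q$ if $d_j$ is a digit of $\mathcal T^{j-1}(P)$ for all $j\ge1$; every sequence is an expansion of exactly one $P=(\alpha,\beta)\in\mathscr Q$, and one sets $\|d_1d_2\cdots\|=\dfrac{-\alpha+\beta+1}{\sqrt2\,\alpha}\in[0,\infty]$. On the alphabet $\{a,b,a^\vee\}$ put $b^\vee=b$, $(a^\vee)^\vee=a$; $w^\vee$ is obtained from the word $w$ by applying ${}^\vee$ to every letter, and $w^*$ is $w$ read backwards. For an infinite word $E$ on $\{a,b,a^\vee\}$ let $\Pi(E)\in\{1,2,3\}^{\mathbb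 N}$ be the result of the substitution $a\mapsto 3\,1$, $b\mapsto 2$, $a^\vee\mapsto 1\,3$. A doubly infinite word is an element of $\{a,b,a^\vee\}^{\mathbb Z}$ up to shifts; its sections are written $E^*|F$ with $E,F$ infinite to the right. Put $$L(E^*|F)=\frac{\|\Pi(E^\vee)\|+\|\Pi(F)\|}{\sqrt2},\qquad L(B)=\sup_{E^*|F}\max\bigl(L(E^*|F),\,L((E^\vee)^*|F^\vee)\bigr),$$ the supremum being over all sections $E^*|F$ of $B$. The word $B$ is admissible if $L(B)\le 2$. Let $\lambda(B)\in\{0,1,2,\dots,\infty\}$ be the supremum of the lengths of the finite words $w$ on $\{a,b,a^\vee\}$ such that $(w^\vee)^*\,b\,a\,w$ occurs as a subword of $B$ (with $\sup\emptyset=0$). For an infinite word $E$ on $\{a,b\}$ let $\jmath(E)$ be obtained from $E$ by replacing every letter $a$ that is preceded by an odd number of $b$'s by $a^\vee$. For a nonempty finite word $w$ on $\{a,b\}$ put $E(w)=\jmath(www\cdots)$, and let $B(w)$ be the doubly infinite word with section $E(w^*)^*|E(w)$. A (lower) Christoffel word is one of the words $a$, $b$, or, for coprime positive integers $s,t$,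 the word that encodes ($a$ = unit step to the right, $b$ = unit step up) the lattice path from $(0,0)$ to $(s,t)$ that lies below the segment joining these two points and is such that there is no lattice point strictly between the path and the segment. **Theorem.** Let $B$ be an admissible doubly infinite word on $\{a,b,a^\vee\}$. 1. If $\lambda(B)=\infty$ or $\lambda(B^\vee)=\infty$, then $L(B)=2$. 2. If $\lambda(B)<\infty$ and $\lambda(B^\vee)<\infty$, then $B$ or $B^\vee$ is equal to $B(w)$ for some Christoffel word $w$. -/

import Mathlib

open scoped ENNReal

namespace Romik

/-! ### The Romik system on the quarter circle -/

/-- The Romik digits `1`, `2`, `3`. -/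
inductive Digit where
  | one
  | two
  | three

/-- The closed unit quarter circle. -/
def quarterCircle : Set (ℝ × ℝ) :=
  {P | 0 ≤ P.1 ∧ 0 ≤ P.2 ∧ P.1 ^ 2 + P.2 ^ 2 = 1}

/-- Romik's map on the quarter circle. -/
noncomputable def romikMap (P : ℝ × ℝ) : ℝ × ℝ :=
  (|2 - P.1 - 2 * P.2| / (3 - 2 * P.1 - 2 * P.2),
   |2 - 2 * P.1 - P.2| / (3 - 2 * P.1 - 2 * P.2))

/-- `d` is a valid Romik digit of the point `P`. Each of the two points `(4/5, 3/5)` and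
`(3/5, 4/5)` has two valid digits. -/
def IsDigit (P : ℝ × ℝ) : Digit → Prop
  | .one => 4 / 5 ≤ P.1 ∧ P.1 ≤ 1
  | .two => 3 / 5 ≤ P.1 ∧ P.1 ≤ 4 / 5
  | .three => 0 ≤ P.1 ∧ P.1 ≤ 3 / 5

/-- `P = [d 0, d 1, d 2, …]`: the sequence `d` is a Romik digit expansion of the point `P` of the
quarter circle. -/
def IsExpansion (P : ℝ × ℝ) (d : ℕ → Digit) : Prop :=
  P ∈ quarterCircle ∧ ∀ j, IsDigit (romikMap^[j] P) (d j)

/-- The point of the quarter circle with digit expansion `d`. (Every digit sequence is an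
expansion of exactly one point.) -/
noncomputable def point (d : ℕ → Digit) : ℝ × ℝ :=
  Classical.epsilon fun P => IsExpansion P d

/-- The stereographic projection `‖(α, β)‖ = (-α + β + 1) / (√2 α)` of the quarter circle onto
`[0, ∞]`; the point `(0, 1)` goes to `∞`. -/
noncomputable def stereo (P : ℝ × ℝ) : ℝ≥0∞ :=
  ENNReal.ofReal (-P.1 + P.2 + 1) / ENNReal.ofReal (√2 * P.1)

/-- `‖[d 0, d 1, …]‖`. -/
noncomputable def digitNorm (d : ℕ → Digit) : ℝ≥0∞ :=
  stereo (point d)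

/-! ### Doubly infinite words -/

/-- Two bi-infinite sequences are equivalent if they are shifts of one another. -/
def shiftSetoid (A : Type) : Setoid (ℤ → A) where
  r S T := ∃ k : ℤ, ∀ j : ℤ, T j = S (j + k)
  iseqv :=
    { refl := fun S => ⟨0, fun j => by simp⟩
      symm := fun {S T} ⟨k, h⟩ => ⟨-k, fun j => by simp [h]⟩
      trans := fun {S T U} ⟨k, h⟩ ⟨l, h'⟩ => ⟨l + k, fun j => by rw [h', h, add_assoc]⟩ }

/-- A (base point free) doubly infinite word on `A`: a bi-infinite sequence up to shifts. -/
def BiWord (A : Type) : Type := Quotient (shiftSetoid A)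

/-- The doubly infinite word with a given section. -/
def BiWord.mk {A : Type} (T : ℤ → A) : BiWord A := Quotient.mk (shiftSetoid A) T

/-- `T` is a section of `B`, that is, an element of the equivalence class `B`. -/
def BiWord.IsSection {A : Type} (B : BiWord A) (T : ℤ → A) : Prop := BiWord.mk T = B

/-- The section `E^* | F = … E 1, E 0 | F 0, F 1, …`. The base point is just before index `0`. -/
def joinSection {A : Type} (E F : ℕ → A) : ℤ → A
  | .ofNat n => F n
  | .negSucc n => E n

/-- The finite word `u` occurs as a subword of the doubly infinite word `B`. -/
def BiWord.Occurs {A : Type} (B : BiWord A) (u : List A) : Prop :=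
  ∃ T, B.IsSection T ∧ ∀ (i : ℕ) (h : i < u.length), T i = u[i]

/-! ### Words on the alphabet `{a, b, a^∨}` -/

/-- The alphabet `{a, b, a^∨}`; the letter `a^∨` is written `av`. -/
inductive Letter where
  | a
  | b
  | av

/-- `a ↦ a^∨`, `b ↦ b`, `a^∨ ↦ a`. -/
def Letter.check : Letter → Letter
  | .a => .av
  | .b => .b
  | .av => .a

/-- The doubly infinite word `B^∨`, obtained by applying `∨` to each letter of `B`. -/
def BiWord.check (B : BiWord Letter) : BiWord Letter :=
  Quotient.map' (s₁ := shiftSetoid Letter) (s₂ := shiftSetoid Letter)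
    (fun T j => (T j).check) (fun _ _ ⟨k, h⟩ => ⟨k, fun j => congrArg Letter.check (h j)⟩) B

/-- The digit substitution `a ↦ 3 1`, `b ↦ 2`, `a^∨ ↦ 1 3` on letters. -/
def Letter.digits : Letter → List Digit
  | .a => [.three, .one]
  | .b => [.two]
  | .av => [.one, .three]

/-- The digits of the first `n` letters of `E`, concatenated. -/
def prefixDigits (E : ℕ → Letter) (n : ℕ) : List Digit :=
  (List.range n).flatMap fun i => (E i).digits

theorem le_length_prefixDigits (E : ℕ → Letter) (n : ℕ) : n ≤ (prefixDigits E n).length := by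
  induction n with
  | zero => simp
  | succ n ih =>
    have h1 : 1 ≤ ((E n).digits).length := by cases E n <;> simp [Letter.digits]
    have h2 : (prefixDigits E (n + 1)).length
        = (prefixDigits E n).length + ((E n).digits).length := by
      simp [prefixDigits, List.range_succ]
    omega

/-- The digit sequence `Π(E)`, obtained by applying the digit substitution to the letters of the
infinite word `E` successively. The first `n + 1` letters already provide at least `n + 1` digits,
so that the default value is never used. -/
def digitSeq (E : ℕ → Letter) (n : ℕ) : Digit :=
  (prefixDigits E (n + 1)).getD n .two

/-- `L(E^* | F) = (‖Π(E^∨)‖ + ‖Π(F)‖) / √2`. -/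
noncomputable def sectionL (E F : ℕ → Letter) : ℝ≥0∞ :=
  (digitNorm (digitSeq fun n => (E n).check) + digitNorm (digitSeq F)) / ENNReal.ofReal √2

/-- The Lagrange number `L(B)`: the supremum over all sections `E^* | F` of `B` of the larger one of
`L(E^* | F)` and `L((E^∨)^* | F^∨)`. -/
noncomputable def lagrange (B : BiWord Letter) : ℝ≥0∞ :=
  ⨆ (E : ℕ → Letter) (F : ℕ → Letter) (_ : B.IsSection (joinSection E F)),
    max (sectionL E F) (sectionL (fun n => (E n).check) (fun n => (F n).check))

/-- `B` is admissible if `L(B) ≤ 2`. -/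
def Admissible (B : BiWord Letter) : Prop := lagrange B ≤ 2

/-- `λ(B)`: the supremum of the lengths of the finite words `w` such that `(w^∨)^* b a w` occurs as a
subword of `B`. -/
noncomputable def lam (B : BiWord Letter) : ℕ∞ :=
  ⨆ (w : List Letter) (_ : B.Occurs ((w.map Letter.check).reverse ++ Letter.b :: Letter.a :: w)),
    (w.length : ℕ∞)

/-! ### Christoffel words and the words `B(w)` -/

/-- The alphabet `{a, b}`. -/
inductive AB where
  | a
  | b
  deriving DecidableEq

/-- `w` is the lower Christoffel word of slope `t / s`. The word `w` encodes a lattice path from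
`(0, 0)` to `(s, t)` (a letter `a` is a unit step to the right, a letter `b` a unit step up), whose
vertices are `((w.take i).count a, (w.take i).count b)`. The path stays below the segment from
`(0, 0)` to `(s, t)`, and no lattice point lies strictly between the path and the segment: a lattice
point `(x, y)` strictly below the segment is not above all vertices of the path with abscissa `x`. -/
def IsLowerChristoffel (s t : ℕ) (w : List AB) : Prop :=
  w.count .a = s ∧ w.count .b = t ∧
  (∀ i ≤ w.length, (w.take i).count .b * s ≤ t * (w.take i).count .a) ∧
  ∀ x y : ℕ, x ≤ s → y * s < t * x →
    ∃ i ≤ w.length, (w.take i).count .a = x ∧ y ≤ (w.take i).count .b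

/-- `w` is a lower Christoffel word: one of the trivial words `a`, `b`, or the lower Christoffel word
of slope `t / s` for some coprime positive integers `s` and `t`. -/
def IsChristoffel (w : List AB) : Prop :=
  w = [.a] ∨ w = [.b] ∨
    ∃ s t : ℕ, 0 < s ∧ 0 < t ∧ Nat.Coprime s t ∧ IsLowerChristoffel s t w

/-- The map `ȷ` from infinite words on `{a, b}` to infinite words on `{a, b, a^∨}`: a letter `a`
becomes `a^∨` if it is preceded by an odd number of letters `b`. -/
def orient (E : ℕ → AB) (k : ℕ) : Letter :=
  match E k with
  | .b => .b
  | .a => if Even ((Finset.range k).filter fun i => E i = .b).card then .a else .av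

/-- The periodic infinite word `w w w …` (only used for nonempty `w`). -/
def power (w : List AB) (n : ℕ) : AB :=
  w.getD (n % w.length) .a

/-- `E(w) = ȷ(w w w …)`. -/
def wordE (w : List AB) : ℕ → Letter := orient (power w)

/-- `B(w)`, the doubly infinite word with section `E(w^*)^* | E(w)`. -/
def wordB (w : List AB) : BiWord Letter :=
  BiWord.mk (joinSection (wordE w.reverse) (wordE w))

end Romik

/-! In the coordinate u = √2·‖·‖ on the quarter circle the letters act as Möbius maps whose images
on u > 0 lie in (2,3), (1,2), (2/3,1) for a, b, a^∨. The maps of a and a^∨ increase, that of b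
decreases, and u ↦ 2/u conjugates each letter to its ∨. A word E thus has a `value`, and
admissibility says that `value` of E^∨ plus `value` of F is at most 4 at every section of B and of
B^∨.

At a section X^* b | a Y the sum is 4 + 1/(x+1) − 1/(y+1), with x the value of X^∨ and y that of Y.
Hence it is at most 4 exactly when y ≤ x, and it is close to 4 when X^∨ and Y have a long common
prefix. The second fact gives part 1 (`two_le_lagrange`).

For part 2, the inequalities force the occurrences of a and a^∨ to alternate in sign according to
the parity of the b's between them (`BiAdm.not_bad_run`), so B is an oriented word S on {a, b}
(`BiAdm.exists_isOrientation`). Values of oriented words increase lexicographically with b < a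
(`value_orient_lt`), so admissibility turns into Markoff's combinatorial condition on S
(`BiAdm.markoff`), and finiteness of both λ's bounds the lengths of the words w in factors w^* b a w
of S.

Markoff's condition excludes having both aa and bb (`Markoff.not_two_doubles`). Up to reversing and
exchanging letters, S is therefore an image under a ↦ a, b ↦ ab; the preimage is again Markoff and
its bound drops by one. Descent ends at a constant word, so S is mechanical of rational slope
(`Markoff.isMechanical`). Its period, read from a suitable base point, is a Christoffel word. -/

namespace Romik
open Filter Topology

/-! ### Letters as Möbius maps and the value of an infinite word -/

/-- The action of a letter on the coordinate `√2 * stereo` of the quarter circle. -/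
noncomputable def Letter.mob : Letter → ℝ → ℝ
  | .a, x => (3 * x + 2) / (x + 1)
  | .b, x => (x + 2) / (x + 1)
  | .av, x => (x + 2) / (x + 3)

theorem two_lt_mob_a {x : ℝ} (hx : 0 < x) : 2 < Letter.a.mob x := by
  simp only [Letter.mob]; rw [lt_div_iff₀ (by linarith)]; linarith

theorem one_lt_mob_b {x : ℝ} (hx : 0 < x) : 1 < Letter.b.mob x := by
  simp only [Letter.mob]; rw [lt_div_iff₀ (by linarith)]; linarith

theorem mob_b_lt_two {x : ℝ} (hx : 0 < x) : Letter.b.mob x < 2 := by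
  simp only [Letter.mob]; rw [div_lt_iff₀ (by linarith)]; linarith

theorem mob_av_lt_one {x : ℝ} (hx : 0 < x) : Letter.av.mob x < 1 := by
  simp only [Letter.mob]; rw [div_lt_iff₀ (by linarith)]; linarith

theorem le_mob (l : Letter) {x : ℝ} (hx : 0 ≤ x) : 2 / 3 ≤ l.mob x := by
  cases l <;> simp only [Letter.mob] <;> rw [le_div_iff₀ (by linarith)] <;> linarith

theorem mob_le (l : Letter) {x : ℝ} (hx : 0 ≤ x) : l.mob x ≤ 3 := by
  cases l <;> simp only [Letter.mob] <;> rw [div_le_iff₀ (by linarith)] <;> linarith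

/-- Each Möbius map has determinant ±1, so differences are divided by a product of two denominators.
The bound 2/3, valid after one letter, makes that product at least (5/3)² > 2. -/
theorem abs_mob_sub_mob_le (l : Letter) {x y : ℝ} (hx : 2 / 3 ≤ x) (hy : 2 / 3 ≤ y) :
    |l.mob x - l.mob y| ≤ 1 / 2 * |x - y| := by
  have key : ∀ c : ℝ, 2 ≤ c → |(x - y) / c| ≤ 1 / 2 * |x - y| := by
    intro c hc
    rw [abs_div, abs_of_pos (by linarith : 0 < c), div_le_iff₀ (by linarith)]
    nlinarith [abs_nonneg (x - y)]
  cases l <;> simp only [Letter.mob]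
  · have : (3 * x + 2) / (x + 1) - (3 * y + 2) / (y + 1) = (x - y) / ((x + 1) * (y + 1)) := by
      have : x + 1 ≠ 0 := by linarith
      have : y + 1 ≠ 0 := by linarith
      field_simp; ring
    rw [this]; exact key _ (by nlinarith)
  · have : (x + 2) / (x + 1) - (y + 2) / (y + 1) = -((x - y) / ((x + 1) * (y + 1))) := by
      have : x + 1 ≠ 0 := by linarith
      have : y + 1 ≠ 0 := by linarith
      field_simp; ring
    rw [this, abs_neg]; exact key _ (by nlinarith)
  · have : (x + 2) / (x + 3) - (y + 2) / (y + 3) = (x - y) / ((x + 3) * (y + 3)) := by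
      have : x + 3 ≠ 0 := by linarith
      have : y + 3 ≠ 0 := by linarith
      field_simp; ring
    rw [this]; exact key _ (by nlinarith)

theorem continuousAt_mob (l : Letter) {x : ℝ} (hx : 0 ≤ x) : ContinuousAt l.mob x := by
  cases l
  · change ContinuousAt (fun x : ℝ => (3 * x + 2) / (x + 1)) x
    exact ContinuousAt.div (by fun_prop) (by fun_prop) (by linarith)
  · change ContinuousAt (fun x : ℝ => (x + 2) / (x + 1)) x
    exact ContinuousAt.div (by fun_prop) (by fun_prop) (by linarith)
  · change ContinuousAt (fun x : ℝ => (x + 2) / (x + 3)) x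
    exact ContinuousAt.div (by fun_prop) (by fun_prop) (by linarith)

theorem mob_check (l : Letter) {x : ℝ} (hx : 0 < x) : l.check.mob (2 / x) = 2 / l.mob x := by
  have h1 : x ≠ 0 := hx.ne'
  have h2 : x + 1 ≠ 0 := by linarith
  have h3 : x + 2 ≠ 0 := by linarith
  have h4 : x + 3 ≠ 0 := by linarith
  have h5 : 3 * x + 2 ≠ 0 := by linarith
  have h6 : 2 + x ≠ 0 := by linarith
  have h7 : 2 + x * 3 ≠ 0 := by linarith
  cases l <;> simp only [Letter.mob, Letter.check] <;> field_simp <;> ring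

/-- The `n`-th approximation of the coordinate of the point with expansion `Π(E)`. -/
noncomputable def approx : ℕ → (ℕ → Letter) → ℝ
  | 0, _ => 1
  | n + 1, E => (E 0).mob (approx n fun k => E (k + 1))

theorem le_approx (n : ℕ) (E : ℕ → Letter) : 2 / 3 ≤ approx n E := by
  induction n generalizing E with
  | zero => norm_num [approx]
  | succ n ih => exact le_mob _ (by linarith [ih fun k => E (k + 1)])

theorem approx_le (n : ℕ) (E : ℕ → Letter) : approx n E ≤ 3 := by
  cases n with
  | zero => norm_num [approx]
  | succ n => exact mob_le _ (by linarith [le_approx n fun k => E (k + 1)])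

theorem abs_approx_sub_le (n : ℕ) (E : ℕ → Letter) :
    |approx n E - approx (n + 1) E| ≤ 3 * (1 / 2) ^ n := by
  induction n generalizing E with
  | zero =>
    rw [abs_le]
    constructor <;> linarith [le_approx 0 E, approx_le 0 E, le_approx 1 E, approx_le 1 E]
  | succ n ih =>
    refine (abs_mob_sub_mob_le (E 0) (le_approx n _) (le_approx (n + 1) _)).trans ?_
    rw [pow_succ]
    linarith [ih fun k => E (k + 1)]

/-- The coordinate `√2 * stereo` of the point with expansion `Π(E)`. -/
noncomputable def value (E : ℕ → Letter) : ℝ := limUnder atTop fun n => approx n E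

theorem tendsto_approx (E : ℕ → Letter) : Tendsto (fun n => approx n E) atTop (𝓝 (value E)) := by
  refine CauchySeq.tendsto_limUnder (cauchySeq_of_le_geometric (1 / 2) 3 (by norm_num) fun n => ?_)
  rw [Real.dist_eq]
  exact abs_approx_sub_le n E

theorem le_value (E : ℕ → Letter) : 2 / 3 ≤ value E :=
  ge_of_tendsto' (tendsto_approx E) fun n => le_approx n E

theorem value_le (E : ℕ → Letter) : value E ≤ 3 :=
  le_of_tendsto' (tendsto_approx E) fun n => approx_le n E

theorem value_pos (E : ℕ → Letter) : 0 < value E := by linarith [le_value E]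

theorem value_eq (E : ℕ → Letter) : value E = (E 0).mob (value fun k => E (k + 1)) := by
  have h1 := (tendsto_approx E).comp (tendsto_add_atTop_nat 1)
  have h2 := ((continuousAt_mob (E 0) (value_pos fun k => E (k + 1)).le).tendsto).comp
    (tendsto_approx fun k => E (k + 1))
  exact tendsto_nhds_unique h1 h2

theorem abs_value_sub_le {m : ℕ} {E F : ℕ → Letter} (h : ∀ n < m, E n = F n) :
    |value E - value F| ≤ 3 * (1 / 2) ^ m := by
  induction m generalizing E F with
  | zero =>
    rw [abs_le]
    constructor <;> linarith [le_value E, value_le E, le_value F, value_le F]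
  | succ m ih =>
    rw [value_eq E, value_eq F, ← h 0 (by omega)]
    refine (abs_mob_sub_mob_le (E 0) (le_value _) (le_value _)).trans ?_
    rw [pow_succ]
    linarith [ih (E := fun k => E (k + 1)) (F := fun k => F (k + 1))
      fun n hn => h (n + 1) (by omega)]

/-- The value of a word is determined by its recursion. -/
theorem eq_value_of_recursion {E : ℕ → Letter} {x : ℕ → ℝ} (hx : ∀ n, 0 ≤ x n)
    (h : ∀ n, x n = (E n).mob (x (n + 1))) : x 0 = value E := by
  have hlow : ∀ n, 2 / 3 ≤ x n := fun n => (h n).symm ▸ le_mob _ (hx _)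
  have hup : ∀ n, x n ≤ 3 := fun n => (h n).symm ▸ mob_le _ (hx _)
  have key : ∀ m n, |x n - value fun k => E (k + n)| ≤ 3 * (1 / 2) ^ m := by
    intro m
    induction m with
    | zero =>
      intro n
      rw [abs_le]
      constructor <;>
        linarith [hlow n, hup n, le_value fun k => E (k + n), value_le fun k => E (k + n)]
    | succ m ih =>
      intro n
      rw [value_eq, h n, Nat.zero_add]
      refine (abs_mob_sub_mob_le (E n) (hlow _) (le_value _)).trans ?_
      rw [pow_succ]
      have := ih (n + 1)
      simp only [show ∀ k, k + (n + 1) = k + 1 + n from fun k => by omega] at this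
      linarith
  have h0 : Tendsto (fun m : ℕ => 3 * (1 / 2 : ℝ) ^ m) atTop (𝓝 0) := by
    simpa using (tendsto_pow_atTop_nhds_zero_of_lt_one (by norm_num : (0 : ℝ) ≤ 1 / 2)
      (by norm_num)).const_mul 3
  have := ge_of_tendsto' h0 fun m => key m 0
  exact sub_eq_zero.mp (abs_nonpos_iff.mp this)

/-- The numbers 2/value of the tails satisfy the recursion of the word with ∨ applied, because u ↦
2/u conjugates the letter maps. -/
theorem value_check (E : ℕ → Letter) : (value fun n => (E n).check) = 2 / value E := by
  refine (eq_value_of_recursion (E := fun n => (E n).check)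
    (x := fun n => 2 / value fun k => E (k + n)) (fun n => ?_) fun n => ?_).symm
  · exact div_nonneg zero_le_two (value_pos _).le
  · rw [mob_check _ (value_pos _), value_eq fun k => E (k + n), Nat.zero_add]
    simp only [show ∀ k, k + 1 + n = k + (n + 1) from fun k => by omega]

theorem Letter.check_check (l : Letter) : l.check.check = l := by cases l <;> rfl

theorem mob_a_eq {x : ℝ} (hx : 0 ≤ x) : Letter.a.mob x = 3 - 1 / (x + 1) := by
  have : x + 1 ≠ 0 := by linarith
  simp only [Letter.mob]; field_simp; ring

theorem mob_b_eq {x : ℝ} (hx : 0 ≤ x) : Letter.b.mob x = 1 + 1 / (x + 1) := by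
  have : x + 1 ≠ 0 := by linarith
  simp only [Letter.mob]; field_simp; ring

theorem mob_a_lt {x y : ℝ} (hx : 0 < x) (h : x < y) : Letter.a.mob x < Letter.a.mob y := by
  simp only [Letter.mob]; rw [div_lt_div_iff₀ (by linarith) (by linarith)]; nlinarith

theorem mob_b_lt {x y : ℝ} (hx : 0 < x) (h : x < y) : Letter.b.mob y < Letter.b.mob x := by
  simp only [Letter.mob]; rw [div_lt_div_iff₀ (by linarith) (by linarith)]; nlinarith

/-- Dropping a leading b changes the parity of all later counts, which amounts to ∨ on the tail. -/
theorem orient_succ_of_b {E : ℕ → AB} (h : E 0 = .b) (n : ℕ) :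
    orient E (n + 1) = (orient (fun k => E (k + 1)) n).check := by
  have hc : ((Finset.range (n + 1)).filter fun i => E i = .b).card
      = ((Finset.range n).filter fun i => E (i + 1) = .b).card + 1 := by
    rw [Finset.card_filter, Finset.card_filter, Finset.sum_range_succ', if_pos h]
  unfold orient
  rw [hc]
  beta_reduce
  cases E (n + 1)
  · by_cases hp : Even ((Finset.range n).filter fun i => E (i + 1) = .b).card <;>
      simp [hp, Nat.even_add_one, Letter.check]
  · rfl

theorem orient_succ_of_a {E : ℕ → AB} (h : E 0 = .a) (n : ℕ) :
    orient E (n + 1) = orient (fun k => E (k + 1)) n := by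
  have hc : ((Finset.range (n + 1)).filter fun i => E i = .b).card
      = ((Finset.range n).filter fun i => E (i + 1) = .b).card := by
    rw [Finset.card_filter, Finset.card_filter, Finset.sum_range_succ', if_neg (by simp [h]),
      add_zero]
  unfold orient
  rw [hc]

theorem orient_zero (E : ℕ → AB) : orient E 0 = match E 0 with | .a => .a | .b => .b := by
  unfold orient
  cases E 0 <;> simp

/-- The value of an oriented word is strictly increasing in the lexicographic order, `b < a`. -/
theorem value_orient_lt {m : ℕ} {E F : ℕ → AB} (h : ∀ n < m, E n = F n) (hE : E m = .b)
    (hF : F m = .a) : value (orient E) < value (orient F) := by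
  induction m generalizing E F with
  | zero =>
    rw [value_eq (orient E), value_eq (orient F), orient_zero, orient_zero, hE, hF]
    exact (mob_b_lt_two (value_pos _)).trans (two_lt_mob_a (value_pos _))
  | succ m ih =>
    have ih' := ih (E := fun k => E (k + 1)) (F := fun k => F (k + 1))
      (fun n hn => h (n + 1) (by omega)) hE hF
    have h0 := h 0 (by omega)
    rw [value_eq (orient E), value_eq (orient F), orient_zero, orient_zero, ← h0]
    cases hE0 : E 0
    · simp only [orient_succ_of_a hE0, orient_succ_of_a (h0 ▸ hE0)]
      exact mob_a_lt (value_pos _) ih'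
    -- A leading b applies a decreasing map to 2/(value of the tail); the two reversals of order
    -- cancel.
    · simp only [orient_succ_of_b hE0, orient_succ_of_b (h0 ▸ hE0), value_check]
      refine mob_b_lt (div_pos two_pos (value_pos _)) ?_
      exact div_lt_div_of_pos_left two_pos (value_pos _) ih'


/-! ### The coordinate on the quarter circle and digit expansions -/

/-- The point of the quarter circle with coordinate `√2 * stereo` equal to `u`. -/
noncomputable def pt (u : ℝ) : ℝ × ℝ :=
  ((2 * u + 2) / (u ^ 2 + 2 * u + 2), (u ^ 2 + 2 * u) / (u ^ 2 + 2 * u + 2))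

theorem pt_mem {u : ℝ} (hu : 0 ≤ u) : pt u ∈ quarterCircle := by
  refine ⟨?_, ?_, ?_⟩
  · simp only [pt]; positivity
  · simp only [pt]; positivity
  · have : u ^ 2 + 2 * u + 2 ≠ 0 := by positivity
    simp only [pt]; field_simp; ring

theorem pt_fst_pos {u : ℝ} (hu : 0 ≤ u) : 0 < (pt u).1 := by
  simp only [pt]; positivity

/-- The excluded point is the one at u = ∞; elsewhere u = (1 − x + y)/x. -/
theorem exists_eq_pt {P : ℝ × ℝ} (hP : P ∈ quarterCircle) (h : P ≠ (0, 1)) :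
    ∃ u, 0 ≤ u ∧ P = pt u := by
  obtain ⟨x, y⟩ := P
  obtain ⟨hx, hy, hxy⟩ := hP
  simp only at hx hy hxy
  have hx0 : x ≠ 0 := by
    rintro rfl
    exact h (Prod.ext rfl (by simp only; nlinarith))
  have hxp : 0 < x := lt_of_le_of_ne hx (Ne.symm hx0)
  have hx1 : x ≤ 1 := by nlinarith
  refine ⟨(1 - x + y) / x, div_nonneg (by linarith) hx, ?_⟩
  have hD : ((1 - x + y) / x) ^ 2 + 2 * ((1 - x + y) / x) + 2 = 2 * (1 + y) / x ^ 2 := by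
    field_simp; nlinarith
  have hy1 : 1 + y ≠ 0 := by linarith
  simp only [pt, hD]
  refine Prod.ext ?_ ?_
  · simp only; field_simp; ring
  · simp only; field_simp; nlinarith

theorem pt_injective {u v : ℝ} (hu : 0 ≤ u) (hv : 0 ≤ v) (h : pt u = pt v) : u = v := by
  have h1 := congrArg Prod.fst h
  simp only [pt] at h1
  rw [div_eq_div_iff (by positivity) (by positivity)] at h1
  have h2 : (u - v) * (u * v + u + v) = 0 := by nlinarith
  rcases mul_eq_zero.mp h2 with h3 | h3
  · linarith
  · have := mul_nonneg hu hv
    linarith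

theorem romikMap_pt {u : ℝ} (hu : 0 ≤ u) :
    romikMap (pt u)
      = (|2 - 2 * u| / (u ^ 2 - 2 * u + 2), |u ^ 2 - 2 * u| / (u ^ 2 - 2 * u + 2)) := by
  have hD : 0 < u ^ 2 + 2 * u + 2 := by positivity
  have h1 : 3 - 2 * (pt u).1 - 2 * (pt u).2 = (u ^ 2 - 2 * u + 2) / (u ^ 2 + 2 * u + 2) := by
    simp only [pt]; field_simp; ring
  have h2 : 2 - (pt u).1 - 2 * (pt u).2 = (2 - 2 * u) / (u ^ 2 + 2 * u + 2) := by
    simp only [pt]; field_simp; ring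
  have h3 : 2 - 2 * (pt u).1 - (pt u).2 = (u ^ 2 - 2 * u) / (u ^ 2 + 2 * u + 2) := by
    simp only [pt]; field_simp; ring
  simp only [romikMap, h1, h2, h3, abs_div, abs_of_pos hD]
  rw [div_div_div_cancel_right₀ hD.ne', div_div_div_cancel_right₀ hD.ne']

theorem romikMap_zero_one : romikMap (0, 1) = (0, 1) := by
  norm_num [romikMap]

theorem romikMap_mem {P : ℝ × ℝ} (hP : P ∈ quarterCircle) : romikMap P ∈ quarterCircle := by
  by_cases h : P = (0, 1)
  · rw [h, romikMap_zero_one]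
    norm_num [quarterCircle]
  · obtain ⟨u, hu, rfl⟩ := exists_eq_pt hP h
    have hD : 0 < u ^ 2 - 2 * u + 2 := by nlinarith [sq_nonneg (u - 1)]
    rw [romikMap_pt hu]
    refine ⟨by positivity, by positivity, ?_⟩
    simp only [div_pow, sq_abs]
    rw [← add_div, div_eq_one_iff_eq (by positivity)]
    ring

/-- The inverse branch of Romik's map belonging to a digit, in the coordinate `√2 * stereo`. -/
noncomputable def Digit.branch : Digit → ℝ → ℝ
  | .one, x => x / (x + 1)
  | .two, x => (x + 2) / (x + 1)
  | .three, x => x + 2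

theorem branch_nonneg (d : Digit) {x : ℝ} (hx : 0 ≤ x) : 0 ≤ d.branch x := by
  cases d <;> simp only [Digit.branch] <;> positivity

theorem four_fifths_le_iff {u : ℝ} (hu : 0 ≤ u) : 4 / 5 ≤ (pt u).1 ↔ u ≤ 1 := by
  simp only [pt]
  rw [div_le_div_iff₀ (by positivity) (by positivity)]
  constructor <;> intro h <;> nlinarith

theorem le_four_fifths_iff {u : ℝ} (hu : 0 ≤ u) : (pt u).1 ≤ 4 / 5 ↔ 1 ≤ u := by
  simp only [pt]
  rw [div_le_div_iff₀ (by positivity) (by positivity)]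
  constructor <;> intro h <;> nlinarith

theorem three_fifths_le_iff {u : ℝ} (hu : 0 ≤ u) : 3 / 5 ≤ (pt u).1 ↔ u ≤ 2 := by
  simp only [pt]
  rw [div_le_div_iff₀ (by positivity) (by positivity)]
  constructor <;> intro h <;> nlinarith

theorem le_three_fifths_iff {u : ℝ} (hu : 0 ≤ u) : (pt u).1 ≤ 3 / 5 ↔ 2 ≤ u := by
  simp only [pt]
  rw [div_le_div_iff₀ (by positivity) (by positivity)]
  constructor <;> intro h <;> nlinarith

theorem isDigit_branch (d : Digit) {x : ℝ} (hx : 0 ≤ x) : IsDigit (pt (d.branch x)) d := by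
  have hb := branch_nonneg d hx
  have hm := pt_mem hb
  cases d
  · refine ⟨(four_fifths_le_iff hb).2 ?_, by nlinarith [hm.1, hm.2.1, hm.2.2]⟩
    simp only [Digit.branch]
    rw [div_le_one (by positivity)]; linarith
  · refine ⟨(three_fifths_le_iff hb).2 ?_, (le_four_fifths_iff hb).2 ?_⟩
    · simp only [Digit.branch]
      rw [div_le_iff₀ (by positivity)]; linarith
    · simp only [Digit.branch]
      rw [le_div_iff₀ (by positivity)]; linarith
  · refine ⟨hm.1, (le_three_fifths_iff hb).2 ?_⟩
    simp only [Digit.branch]; linarith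

theorem romikMap_branch (d : Digit) {x : ℝ} (hx : 0 ≤ x) : romikMap (pt (d.branch x)) = pt x := by
  rw [romikMap_pt (branch_nonneg d hx)]
  have h1 : 0 < x + 1 := by linarith
  have hD : x ^ 2 + 2 * x + 2 ≠ 0 := by positivity
  cases d
  · have e1 : 2 - 2 * Digit.one.branch x = 2 / (x + 1) := by
      simp only [Digit.branch]; field_simp; ring
    have e2 : (Digit.one.branch x) ^ 2 - 2 * Digit.one.branch x
        = -((x ^ 2 + 2 * x) / (x + 1) ^ 2) := by
      simp only [Digit.branch]; field_simp; ring
    have e3 : (-((x ^ 2 + 2 * x) / (x + 1) ^ 2)) + 2 = (x ^ 2 + 2 * x + 2) / (x + 1) ^ 2 := by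
      field_simp; ring
    rw [e1, e2, e3, abs_neg, abs_of_nonneg (by positivity), abs_of_nonneg (by positivity)]
    refine Prod.ext ?_ ?_ <;> simp only [pt] <;> field_simp
  · have e1 : 2 - 2 * Digit.two.branch x = -(2 / (x + 1)) := by
      simp only [Digit.branch]; field_simp; ring
    have e2 : (Digit.two.branch x) ^ 2 - 2 * Digit.two.branch x
        = -((x ^ 2 + 2 * x) / (x + 1) ^ 2) := by
      simp only [Digit.branch]; field_simp; ring
    have e3 : (-((x ^ 2 + 2 * x) / (x + 1) ^ 2)) + 2 = (x ^ 2 + 2 * x + 2) / (x + 1) ^ 2 := by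
      field_simp; ring
    rw [e1, e2, e3, abs_neg, abs_neg, abs_of_nonneg (by positivity), abs_of_nonneg (by positivity)]
    refine Prod.ext ?_ ?_ <;> simp only [pt] <;> field_simp
  · have e1 : 2 - 2 * Digit.three.branch x = -(2 * x + 2) := by
      simp only [Digit.branch]; ring
    have e2 : (Digit.three.branch x) ^ 2 - 2 * Digit.three.branch x = x ^ 2 + 2 * x := by
      simp only [Digit.branch]; ring
    rw [e1, e2, abs_neg, abs_of_nonneg (by positivity), abs_of_nonneg (by positivity), pt]

theorem eq_pt_branch {P : ℝ × ℝ} {d : Digit} {y : ℝ} (hP : P ∈ quarterCircle) (hd : IsDigit P d)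
    (hy : 0 ≤ y) (h : romikMap P = pt y) : P = pt (d.branch y) := by
  have hP1 : P ≠ (0, 1) := by
    rintro rfl
    rw [romikMap_zero_one] at h
    exact (pt_fst_pos hy).ne (congrArg Prod.fst h)
  obtain ⟨u, hu, rfl⟩ := exists_eq_pt hP hP1
  -- Romik's map sends u = 1 to (0, 1), the point at infinity, which is no `pt y`. This keeps the
  -- denominators below nonzero.
  have hu1 : d ≠ .three → u ≠ 1 := by
    rintro - rfl
    rw [romikMap_pt zero_le_one] at h
    exact (pt_fst_pos hy).ne (by rw [← h]; norm_num)
  suffices hx : ∃ x, 0 ≤ x ∧ d.branch x = u by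
    obtain ⟨x, hx, rfl⟩ := hx
    rw [romikMap_branch d hx] at h
    rw [pt_injective hx hy h]
  cases d
  · have h1 := (four_fifths_le_iff hu).1 hd.1
    have h2 : 0 < 1 - u := by
      have := lt_of_le_of_ne h1 (hu1 (by simp)); linarith
    refine ⟨u / (1 - u), by positivity, ?_⟩
    simp only [Digit.branch]; field_simp; ring
  · have h1 := (three_fifths_le_iff hu).1 hd.1
    have h2 : 0 < u - 1 := by
      have := lt_of_le_of_ne ((le_four_fifths_iff hu).1 hd.2) (hu1 (by simp)).symm; linarith
    refine ⟨(2 - u) / (u - 1), div_nonneg (by linarith) h2.le, ?_⟩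
    have h3 : (2 - u) / (u - 1) + 1 = 1 / (u - 1) := by field_simp; ring
    have h4 : (2 - u) / (u - 1) + 2 = u / (u - 1) := by field_simp; ring
    simp only [Digit.branch, h3, h4]; field_simp
  · have h1 := (le_three_fifths_iff hu).1 hd.2
    exact ⟨u - 2, by linarith, by simp [Digit.branch]⟩

theorem mob_eq_foldr (l : Letter) {x : ℝ} (hx : 0 ≤ x) :
    l.mob x = l.digits.foldr Digit.branch x := by
  have h1 : x + 1 ≠ 0 := by linarith
  have h3 : x + 3 ≠ 0 := by linarith
  have h2 : x + 2 + 1 = x + 3 := by ring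
  cases l
  · simp only [Letter.mob, Letter.digits, List.foldr, Digit.branch]; field_simp; ring
  · simp only [Letter.mob, Letter.digits, List.foldr, Digit.branch]
  · simp only [Letter.mob, Letter.digits, List.foldr, Digit.branch, h2]

theorem prefixDigits_succ (E : ℕ → Letter) (n : ℕ) :
    prefixDigits E (n + 1) = (E 0).digits ++ prefixDigits (fun k => E (k + 1)) n := by
  simp [prefixDigits, List.range_succ_eq_map, List.flatMap_map]

theorem prefixDigits_getElem? (E : ℕ → Letter) {i m n : ℕ} (hmn : m ≤ n)
    (hi : i < (prefixDigits E m).length) : (prefixDigits E n)[i]? = (prefixDigits E m)[i]? := by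
  obtain ⟨k, rfl⟩ := Nat.exists_eq_add_of_le hmn
  have : prefixDigits E (m + k) = prefixDigits E m
      ++ (List.range k).flatMap fun i => (E (m + i)).digits := by
    simp [prefixDigits, List.range_add, List.flatMap_map]
  rw [this, List.getElem?_append_left hi]

theorem getElem?_prefixDigits (E : ℕ → Letter) {i n : ℕ} (hi : i < n) :
    (prefixDigits E n)[i]? = some (digitSeq E i) := by
  have h := le_length_prefixDigits E (i + 1)
  rw [prefixDigits_getElem? E hi h, digitSeq, List.getElem?_eq_getElem h,
    List.getD_eq_getElem _ _ h]

theorem digitSeq_add (E : ℕ → Letter) (n : ℕ) :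
    digitSeq E (n + (E 0).digits.length) = digitSeq (fun k => E (k + 1)) n := by
  have h := getElem?_prefixDigits E (i := n + (E 0).digits.length)
    (n := n + (E 0).digits.length + 1) (by omega)
  rw [prefixDigits_succ, List.getElem?_append_right (by omega), Nat.add_sub_cancel,
    getElem?_prefixDigits _ (by cases E 0 <;> simp [Letter.digits])] at h
  exact (Option.some.inj h).symm

theorem digitSeq_of_lt (E : ℕ → Letter) {n : ℕ} (hn : n < (E 0).digits.length) :
    digitSeq E n = (E 0).digits[n] := by
  have h := getElem?_prefixDigits E (i := n) (n := n + 1) (by omega)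
  rw [prefixDigits_succ, List.getElem?_append_left hn, List.getElem?_eq_getElem hn] at h
  exact (Option.some.inj h).symm

theorem iterate_romikMap_mob (l : Letter) {x : ℝ} (hx : 0 ≤ x) :
    romikMap^[l.digits.length] (pt (l.mob x)) = pt x := by
  rw [mob_eq_foldr l hx]
  cases l <;> simp [Letter.digits, Function.iterate_succ, romikMap_branch, hx, branch_nonneg]

theorem isDigit_iterate_mob (l : Letter) {x : ℝ} (hx : 0 ≤ x) {n : ℕ} (hn : n < l.digits.length) :
    IsDigit (romikMap^[n] (pt (l.mob x))) l.digits[n] := by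
  rw [mob_eq_foldr l hx]
  cases l <;> simp only [Letter.digits, List.length_cons, List.length_nil] at hn <;>
    interval_cases n <;>
    simp [Letter.digits, romikMap_branch, isDigit_branch, hx, branch_nonneg]

theorem isExpansion_pt_value (E : ℕ → Letter) : IsExpansion (pt (value E)) (digitSeq E) := by
  refine ⟨pt_mem (value_pos E).le, fun j => ?_⟩
  induction j using Nat.strong_induction_on generalizing E with
  | _ j ih =>
    rw [value_eq E]
    rcases lt_or_ge j (E 0).digits.length with hj | hj
    · rw [digitSeq_of_lt E hj]
      exact isDigit_iterate_mob _ (value_pos _).le hj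
    · obtain ⟨n, rfl⟩ := Nat.exists_eq_add_of_le' hj
      rw [digitSeq_add, Function.iterate_add_apply, iterate_romikMap_mob _ (value_pos _).le]
      exact ih n (by cases E 0 <;> simp [Letter.digits]) _

theorem iterate_romikMap_mem {P : ℝ × ℝ} (hP : P ∈ quarterCircle) (n : ℕ) :
    romikMap^[n] P ∈ quarterCircle := by
  induction n with
  | zero => exact hP
  | succ n ih => rw [Function.iterate_succ_apply']; exact romikMap_mem ih

theorem IsExpansion.tail {P : ℝ × ℝ} {E : ℕ → Letter} (h : IsExpansion P (digitSeq E)) :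
    IsExpansion (romikMap^[(E 0).digits.length] P) (digitSeq fun k => E (k + 1)) := by
  refine ⟨iterate_romikMap_mem h.1 _, fun j => ?_⟩
  rw [← digitSeq_add, ← Function.iterate_add_apply]
  exact h.2 _

/-- The point (0, 1) is fixed and only has the digit 3, whereas the digits of any letter include a 1
or a 2. -/
theorem IsExpansion.ne_zero_one {P : ℝ × ℝ} {E : ℕ → Letter} (h : IsExpansion P (digitSeq E)) :
    P ≠ (0, 1) := by
  rintro rfl
  have h0 := h.2 0
  have h1 := h.2 1
  have hl := digitSeq_of_lt E (n := 0)
  have hl1 := digitSeq_of_lt E (n := 1)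
  simp only [Function.iterate_one, romikMap_zero_one, Function.iterate_zero, id] at h0 h1
  cases hE : E 0
  · simp only [hE, Letter.digits] at hl1
    rw [hl1 (by simp)] at h1
    exact absurd h1.1 (by norm_num)
  · simp only [hE, Letter.digits] at hl
    rw [hl (by simp)] at h0
    exact absurd h0.1 (by norm_num)
  · simp only [hE, Letter.digits] at hl
    rw [hl (by simp)] at h0
    exact absurd h0.1 (by norm_num)

theorem IsExpansion.eq_pt_mob {P : ℝ × ℝ} {E : ℕ → Letter} (h : IsExpansion P (digitSeq E)) {y : ℝ}
    (hy : 0 ≤ y) (hPy : romikMap^[(E 0).digits.length] P = pt y) : P = pt ((E 0).mob y) := by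
  have hd : ∀ (n : ℕ) (hn : n < (E 0).digits.length), IsDigit (romikMap^[n] P) (E 0).digits[n] :=
    fun n hn => digitSeq_of_lt E hn ▸ h.2 n
  rw [mob_eq_foldr _ hy]
  cases hE : E 0 <;> simp only [hE, Letter.digits, List.length_cons, List.length_nil] at hd hPy
  · have h1 := eq_pt_branch (romikMap_mem h.1) (hd 1 (by norm_num)) hy hPy
    exact eq_pt_branch h.1 (hd 0 (by norm_num)) (branch_nonneg _ hy) h1
  · exact eq_pt_branch h.1 (hd 0 (by norm_num)) hy hPy
  · have h1 := eq_pt_branch (romikMap_mem h.1) (hd 1 (by norm_num)) hy hPy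
    exact eq_pt_branch h.1 (hd 0 (by norm_num)) (branch_nonneg _ hy) h1

theorem IsExpansion.eq_pt_value {P : ℝ × ℝ} {E : ℕ → Letter} (h : IsExpansion P (digitSeq E)) :
    P = pt (value E) := by
  -- Orbit points at the starts of the digit blocks of successive letters. Their coordinates satisfy
  -- the recursion that characterizes `value`, whence uniqueness.
  let Q : ℕ → ℝ × ℝ := fun n => n.rec P fun n R => romikMap^[(E n).digits.length] R
  have hQ : ∀ n, IsExpansion (Q n) (digitSeq fun k => E (k + n)) := by
    intro n
    induction n with
    | zero => exact h
    | succ n ih =>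
      have ht := ih.tail
      simp only [Nat.zero_add, show ∀ k, k + 1 + n = k + (n + 1) from fun k => by omega] at ht
      exact ht
  choose x hx0 hx using fun n => exists_eq_pt (hQ n).1 (hQ n).ne_zero_one
  change Q 0 = _
  rw [hx 0]
  congr 1
  refine eq_value_of_recursion hx0 fun n => ?_
  have hm := (hQ n).eq_pt_mob (hx0 (n + 1)) (by rw [← hx (n + 1), Nat.zero_add])
  rw [hx n, Nat.zero_add] at hm
  exact pt_injective (hx0 n) (le_trans (by norm_num) (le_mob _ (hx0 _))) hm

theorem point_digitSeq (E : ℕ → Letter) : point (digitSeq E) = pt (value E) :=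
  IsExpansion.eq_pt_value
    (Classical.epsilon_spec (p := fun P => IsExpansion P (digitSeq E)) ⟨_, isExpansion_pt_value E⟩)

theorem digitNorm_digitSeq (E : ℕ → Letter) :
    digitNorm (digitSeq E) = ENNReal.ofReal (value E / √2) := by
  have hu := value_pos E
  rw [digitNorm, point_digitSeq, stereo, ← ENNReal.ofReal_div_of_pos
    (mul_pos (by positivity) (pt_fst_pos hu.le))]
  congr 1
  simp only [pt]
  field_simp
  ring

theorem sectionL_eq (E F : ℕ → Letter) :
    sectionL E F = ENNReal.ofReal (((value fun n => (E n).check) + value F) / 2) := by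
  have h1 := value_pos fun n => (E n).check
  have h2 := value_pos F
  rw [sectionL, digitNorm_digitSeq, digitNorm_digitSeq, ← ENNReal.ofReal_add (by positivity)
    (by positivity), ← ENNReal.ofReal_div_of_pos (by positivity)]
  congr 1
  rw [← add_div, div_div, Real.mul_self_sqrt zero_le_two]


/-! ### Sections and the admissibility inequalities -/

/-- The infinite word read to the right from index `c`. -/
def rightOf {A : Type} (T : ℤ → A) (c : ℤ) : ℕ → A := fun n => T (c + n)

/-- The infinite word read to the left from index `c`. -/
def leftOf {A : Type} (T : ℤ → A) (c : ℤ) : ℕ → A := fun n => T (c - n)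

theorem BiWord.IsSection.shift {A : Type} {B : BiWord A} {T : ℤ → A} (h : B.IsSection T) (k : ℤ) :
    B.IsSection fun j => T (j + k) :=
  (Quotient.sound (s := shiftSetoid A) ⟨-k, fun j => by simp⟩).trans h

theorem joinSection_leftOf_rightOf {A : Type} (T : ℤ → A) (c : ℤ) :
    joinSection (leftOf T (c - 1)) (rightOf T c) = fun j => T (j + c) := by
  funext j
  cases j with
  | ofNat n => simp [joinSection, rightOf, add_comm]
  | negSucc n => simp only [joinSection, leftOf, Int.negSucc_eq]; congr 1; ring

theorem BiWord.exists_isSection {A : Type} (B : BiWord A) : ∃ T, B.IsSection T :=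
  Quotient.exists_rep B

theorem BiWord.IsSection.check {B : BiWord Letter} {T : ℤ → Letter} (h : B.IsSection T) :
    B.check.IsSection fun j => (T j).check := by
  subst h; rfl

theorem BiWord.check_check (B : BiWord Letter) : B.check.check = B := by
  obtain ⟨T, hT⟩ := B.exists_isSection
  have h := hT.check.check
  simp only [Letter.check_check] at h
  exact h.symm.trans hT

theorem le_lagrange {B : BiWord Letter} {T : ℤ → Letter} (h : B.IsSection T) (c : ℤ) :
    ENNReal.ofReal (((value fun n => (leftOf T c n).check) + value (rightOf T (c + 1))) / 2)
      ≤ lagrange B := by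
  rw [← sectionL_eq]
  refine le_trans (le_max_left _ (sectionL (fun n => (leftOf T c n).check)
    fun n => (rightOf T (c + 1) n).check)) ?_
  refine le_iSup_of_le (leftOf T c) (le_iSup_of_le (rightOf T (c + 1)) (le_iSup_of_le ?_ le_rfl))
  have := joinSection_leftOf_rightOf T (c + 1)
  rw [add_sub_cancel_right] at this
  rw [this]
  exact h.shift _

theorem joinSection_check (E F : ℕ → Letter) :
    joinSection (fun n => (E n).check) (fun n => (F n).check)
      = fun j => (joinSection E F j).check := by
  funext j
  cases j <;> rfl

theorem lagrange_check_le (B : BiWord Letter) : lagrange B.check ≤ lagrange B := by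
  refine iSup_le fun E => iSup_le fun F => iSup_le fun h => ?_
  have h' := h.check
  rw [BiWord.check_check, ← joinSection_check] at h'
  refine le_iSup_of_le (fun n => (E n).check) (le_iSup_of_le (fun n => (F n).check)
    (le_iSup_of_le h' ?_))
  simp only [Letter.check_check]
  rw [max_comm]

theorem lagrange_check (B : BiWord Letter) : lagrange B.check = lagrange B := by
  refine le_antisymm (lagrange_check_le B) ?_
  have := lagrange_check_le B.check
  rwa [BiWord.check_check] at this

/-- All the sections of `T` (but not necessarily those of `T^∨`) satisfy the admissibility
inequality. -/
def Adm (T : ℤ → Letter) : Prop :=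
  ∀ c, (value fun n => (leftOf T c n).check) + value (rightOf T (c + 1)) ≤ 4

theorem Admissible.adm {B : BiWord Letter} (hB : Admissible B) {T : ℤ → Letter}
    (h : B.IsSection T) : Adm T := by
  intro c
  have h1 := (le_lagrange h c).trans hB
  rw [ENNReal.ofReal_le_iff_le_toReal (by simp)] at h1
  norm_num at h1
  linarith

theorem Admissible.check {B : BiWord Letter} (hB : Admissible B) : Admissible B.check := by
  rwa [Admissible, lagrange_check]

theorem value_of_head {E : ℕ → Letter} {l : Letter} (h : E 0 = l) :
    value E = l.mob (value fun n => E (n + 1)) := h ▸ value_eq E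

theorem leftOf_succ {A : Type} (T : ℤ → A) (c : ℤ) (n : ℕ) :
    leftOf T c (n + 1) = leftOf T (c - 1) n := by
  simp only [leftOf]; congr 1; push_cast; ring

theorem rightOf_succ {A : Type} (T : ℤ → A) (c : ℤ) (n : ℕ) :
    rightOf T c (n + 1) = rightOf T (c + 1) n := by
  simp only [rightOf]; congr 1; push_cast; ring

theorem value_leftOf_check {T : ℤ → Letter} {c : ℤ} {l : Letter} (h : T c = l) :
    (value fun n => (leftOf T c n).check)
      = l.check.mob (value fun n => (leftOf T (c - 1) n).check) := by
  rw [value_of_head (l := l.check) (by simp [leftOf, h])]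
  simp only [leftOf_succ]

theorem value_rightOf {T : ℤ → Letter} {c : ℤ} {l : Letter} (h : T c = l) :
    value (rightOf T c) = l.mob (value (rightOf T (c + 1))) := by
  rw [value_of_head (l := l) (by simp [rightOf, h])]
  simp only [rightOf_succ]

theorem value_leftOf {T : ℤ → Letter} {c : ℤ} {l : Letter} (h : T c = l) :
    value (leftOf T c) = l.mob (value (leftOf T (c - 1))) := by
  rw [value_of_head (l := l) (by simp [leftOf, h])]
  simp only [leftOf_succ]

theorem value_rightOf_check {T : ℤ → Letter} {c : ℤ} {l : Letter} (h : T c = l) :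
    (value fun n => (rightOf T c n).check)
      = l.check.mob (value fun n => (rightOf T (c + 1) n).check) := by
  rw [value_of_head (l := l.check) (by simp [rightOf, h])]
  simp only [rightOf_succ]

/-- The sum equals 4 + 1/(x+1) − 1/(y+1). This turns the metric condition at a section b | a into an
order comparison of the two sides. -/
theorem mob_b_add_mob_a_le_iff {x y : ℝ} (hx : 0 < x) (hy : 0 < y) :
    Letter.b.mob x + Letter.a.mob y ≤ 4 ↔ y ≤ x := by
  rw [mob_b_eq hx.le, mob_a_eq hy.le]
  have h : 1 / (x + 1) ≤ 1 / (y + 1) ↔ y + 1 ≤ x + 1 :=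
    one_div_le_one_div (by linarith) (by linarith)
  constructor
  · intro h1; linarith [h.1 (by linarith)]
  · intro h1; linarith [h.2 (by linarith)]

/-- At a section a^∨ | a both summands exceed 2. -/
theorem Adm.not_av_a {T : ℤ → Letter} (h : Adm T) {c : ℤ} (h1 : T c = .av) (h2 : T (c + 1) = .a) :
    False := by
  have h3 := h c
  rw [value_leftOf_check h1, value_rightOf h2] at h3
  have h4 := two_lt_mob_a (value_pos fun n => (leftOf T (c - 1) n).check)
  have h5 := two_lt_mob_a (value_pos (rightOf T (c + 1 + 1)))
  change Letter.a.mob _ + _ ≤ 4 at h3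
  linarith

theorem Adm.right_le_left {T : ℤ → Letter} (h : Adm T) {c : ℤ} (h1 : T c = .b)
    (h2 : T (c + 1) = .a) :
    value (rightOf T (c + 2)) ≤ value fun n => (leftOf T (c - 1) n).check := by
  have h3 := h c
  rw [value_leftOf_check h1, value_rightOf h2] at h3
  rw [show c + 1 + 1 = c + 2 by ring] at h3
  exact (mob_b_add_mob_a_le_iff (value_pos _) (value_pos _)).1 h3

/-- A section a | b of T is a section a^∨ | b of T^∨, whose sum is the same expression as at b | a
with the two sides interchanged. -/
theorem Adm.left_le_right {T : ℤ → Letter} (h : Adm fun j => (T j).check) {c : ℤ} (h1 : T c = .a)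
    (h2 : T (c + 1) = .b) :
    value (leftOf T (c - 1)) ≤ value fun n => (rightOf T (c + 2) n).check := by
  have h3 := h c
  have e1 : (fun n => (leftOf (fun j => (T j).check) c n).check) = leftOf T c := by
    funext n; exact Letter.check_check _
  have e2 : rightOf (fun j => (T j).check) (c + 1) = fun n => (rightOf T (c + 1) n).check := rfl
  rw [e1, e2, value_leftOf h1, value_rightOf_check h2] at h3
  rw [show c + 1 + 1 = c + 2 by ring, add_comm] at h3
  exact (mob_b_add_mob_a_le_iff (value_pos _) (value_pos _)).1 h3

/-! ### Infinite λ forces the Lagrange number up to 2 -/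

/-- Occurrences of `(w^∨)^* b a w`, described by a section based at the distinguished letter `b`. -/
theorem occurs_iff (B : BiWord Letter) (w : List Letter) :
    B.Occurs ((w.map Letter.check).reverse ++ Letter.b :: Letter.a :: w) ↔
      ∃ T, B.IsSection T ∧ T 0 = .b ∧ T 1 = .a ∧
        ∀ (n : ℕ) (h : n < w.length), T (2 + n) = w[n] ∧ T (-1 - n) = w[n].check := by
  constructor
  · rintro ⟨T, hT, h⟩
    have key : ∀ (i : ℕ) (l : Letter),
        ((w.map Letter.check).reverse ++ Letter.b :: Letter.a :: w)[i]? = some l → T i = l := by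
      intro i l hi
      obtain ⟨hlt, he⟩ := List.getElem?_eq_some_iff.mp hi
      rw [h i hlt, he]
    refine ⟨_, hT.shift w.length, ?_, ?_, fun n hn => ⟨?_, ?_⟩⟩
    · have := key w.length .b (by rw [List.getElem?_append_right (by simp)]; simp)
      simpa using this
    · have := key (w.length + 1) .a (by rw [List.getElem?_append_right (by simp)]; simp)
      rw [← this]; congr 1; push_cast; ring
    · have := key (w.length + 2 + n) w[n] (by
        rw [List.getElem?_append_right (by simp; omega)]
        simp [show w.length + 2 + n - w.length = n + 2 by omega, hn])
      rw [← this]; congr 1; push_cast; ring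
    · have := key (w.length - 1 - n) w[n].check (by
        rw [List.getElem?_append_left (by simp; omega), List.getElem?_reverse (by simp; omega)]
        simp [show w.length - 1 - (w.length - 1 - n) = n by omega, hn])
      rw [← this]; congr 1; omega
  · rintro ⟨T, hT, hb, ha, h⟩
    refine ⟨_, hT.shift (-w.length), fun i hi => ?_⟩
    simp only [List.length_append, List.length_reverse, List.length_map, List.length_cons] at hi
    rcases lt_or_ge i w.length with h1 | h1
    · rw [List.getElem_append_left (by simpa using h1), List.getElem_reverse, List.getElem_map,
        ← (h _ _).2]
      congr 1
      simp only [List.length_map]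
      omega
    · obtain ⟨k, rfl⟩ := Nat.exists_eq_add_of_le h1
      rw [List.getElem_append_right (by simp)]
      simp only [List.length_reverse, List.length_map, Nat.add_sub_cancel_left]
      match k with
      | 0 => simpa using hb
      | 1 => simp [← ha]
      | k + 2 =>
        simp only [List.getElem_cons_succ]
        rw [← (h k (by omega)).1]
        congr 1
        push_cast; ring

theorem two_le_lagrange {B : BiWord Letter} (h : lam B = ⊤) : 2 ≤ lagrange B := by
  have key : ∀ n : ℕ, ENNReal.ofReal (2 - 3 * (1 / 2) ^ n) ≤ lagrange B := by
    intro n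
    have hn : (n : ℕ∞) < lam B := by rw [h]; exact ENat.natCast_lt_top n
    obtain ⟨w, hw⟩ := lt_iSup_iff.mp hn
    obtain ⟨hocc, hnw⟩ := lt_iSup_iff.mp hw
    obtain ⟨T, hT, hb, ha, hw⟩ := (occurs_iff B w).mp hocc
    refine le_trans (ENNReal.ofReal_le_ofReal ?_) (le_lagrange hT 0)
    rw [value_leftOf_check hb, value_rightOf (l := .a) (by simpa using ha)]
    -- Both sides of b | a start with at least n letters of w once ∨ is applied on the left, so by
    -- contraction their values differ by at most 3·2⁻ⁿ.
    have hd := abs_value_sub_le (m := n) (E := fun n => (leftOf T (0 - 1) n).check)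
      (F := rightOf T (0 + 1 + 1)) (fun k hk => by
        have hk' : k < w.length := by
          have : n < w.length := by exact_mod_cast hnw
          omega
        simp only [leftOf, rightOf]
        rw [show (0 : ℤ) - 1 - k = -1 - k by ring, show (0 : ℤ) + 1 + 1 + k = 2 + k by ring,
          (hw k hk').1, (hw k hk').2, Letter.check_check])
    have hx := value_pos fun n => (leftOf T (0 - 1) n).check
    have hy := value_pos (rightOf T (0 + 1 + 1))
    revert hd hx hy
    generalize (value fun n => (leftOf T (0 - 1) n).check) = x
    generalize value (rightOf T (0 + 1 + 1)) = y
    intro hd hx hy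
    simp only [Letter.check]
    rw [mob_b_eq hx.le, mob_a_eq hy.le]
    have h1 : 1 / (y + 1) - 1 / (x + 1) ≤ |x - y| := by
      have : 1 / (y + 1) - 1 / (x + 1) = (x - y) / ((y + 1) * (x + 1)) := by
        have : x + 1 ≠ 0 := by linarith
        have : y + 1 ≠ 0 := by linarith
        field_simp; ring
      rw [this, div_le_iff₀ (by positivity)]
      nlinarith [le_abs_self (x - y), abs_nonneg (x - y), mul_pos hx hy,
        mul_nonneg (abs_nonneg (x - y)) hx.le, mul_nonneg (abs_nonneg (x - y)) hy.le,
        mul_nonneg (abs_nonneg (x - y)) (mul_pos hx hy).le]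
    have h2 : (0 : ℝ) < (1 / 2) ^ n := by positivity
    linarith
  have hlim : Tendsto (fun n : ℕ => ENNReal.ofReal (2 - 3 * (1 / 2) ^ n)) atTop
      (𝓝 (ENNReal.ofReal (2 - 3 * 0))) :=
    ENNReal.tendsto_ofReal ((tendsto_const_nhds).sub
      ((tendsto_pow_atTop_nhds_zero_of_lt_one (by norm_num) (by norm_num)).const_mul 3))
  have := le_of_tendsto' hlim key
  simpa using this


/-! ### Signs alternate with the parity of runs of b -/

/-- The rank of a letter in the order `a^∨ < b < a`. -/
def Letter.rank : Letter → ℕ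
  | .av => 0
  | .b => 1
  | .a => 2

theorem value_lt_of_rank_lt {E F : ℕ → Letter} (h : (E 0).rank < (F 0).rank) :
    value E < value F := by
  rw [value_eq E, value_eq F]
  have hE := value_pos fun n => E (n + 1)
  have hF := value_pos fun n => F (n + 1)
  have h1 := mob_av_lt_one hE
  have h2 := one_lt_mob_b hF
  have h3 := mob_b_lt_two hE
  have h4 := two_lt_mob_a hF
  cases hE0 : E 0 <;> cases hF0 : F 0 <;> simp [hE0, hF0, Letter.rank] at h <;> linarith

/-- Comparison of the values of two words that start with a common power of `b`. -/
theorem value_lt_of_common_b {m : ℕ} {E F : ℕ → Letter} (hE : ∀ n < m, E n = .b)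
    (hF : ∀ n < m, F n = .b) (h0 : Even m → (E m).rank < (F m).rank)
    (h1 : ¬Even m → (F m).rank < (E m).rank) : value E < value F := by
  induction m generalizing E F with
  | zero => exact value_lt_of_rank_lt (h0 (by simp))
  | succ m ih =>
    rw [value_of_head (hE 0 (by omega)), value_of_head (hF 0 (by omega))]
    refine mob_b_lt (value_pos _) (ih (E := fun n => F (n + 1)) (F := fun n => E (n + 1))
      (fun n hn => hF _ (by omega)) (fun n hn => hE _ (by omega)) ?_ ?_)
    · intro h; exact h1 (by simp [Nat.even_add_one, h])
    · intro h; exact h0 (by simp [Nat.even_add_one, h])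

/-- Both `T` and `T^∨` satisfy the admissibility inequalities. -/
def BiAdm (T : ℤ → Letter) : Prop := Adm T ∧ Adm fun j => (T j).check

theorem BiAdm.check {T : ℤ → Letter} (h : BiAdm T) : BiAdm fun j => (T j).check :=
  ⟨h.2, by simpa only [Letter.check_check] using h.1⟩

theorem Admissible.biAdm {B : BiWord Letter} (hB : Admissible B) {T : ℤ → Letter}
    (h : B.IsSection T) : BiAdm T :=
  ⟨hB.adm h, hB.check.adm h.check⟩

/-- In an admissible word, `k` consecutive letters `b` between two other letters reverse the
orientation if and only if `k` is odd. -/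
theorem BiAdm.not_bad_run (k : ℕ) {T : ℤ → Letter} (h : BiAdm T) {j : ℤ} (hj : T j = .a)
    (hb : ∀ m : ℕ, m < k → T (j - 1 - m) = .b)
    (hk : T (j - 1 - k) = if Even k then .av else .a) : False := by
  induction k using Nat.strong_induction_on generalizing T j with
  | _ k ih =>
    rcases k with _ | k
    · exact h.1.not_av_a (c := j - 1) (by simpa using hk) (by simpa using hj)
    -- The section b | a before index j gives value Y ≤ value X for the words X, Y below; the
    -- remaining steps prove value X < value Y.
    have hle := h.1.right_le_left (c := j - 1) (by simpa using hb 0 (by omega)) (by simpa using hj)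
    refine hle.not_gt ?_
    set X : ℕ → Letter := fun n => (leftOf T (j - 1 - 1) n).check with hX
    set Y : ℕ → Letter := rightOf T (j - 1 + 2) with hY
    have hXb : ∀ n < k, X n = .b := by
      intro n hn
      have := hb (n + 1) (by omega)
      simp only [hX, leftOf]
      rw [show j - 1 - 1 - (n : ℤ) = j - 1 - ((n + 1 : ℕ) : ℤ) by push_cast; ring, this]
      rfl
    have hXk : X k = if Even k then .av else .a := by
      simp only [hX, leftOf]
      rw [show j - 1 - 1 - (k : ℤ) = j - 1 - ((k + 1 : ℕ) : ℤ) by push_cast; ring, hk]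
      by_cases hp : Even k <;> simp [Nat.even_add_one, hp, Letter.check]
    -- The first letter of Y other than b ends a run of m letters b after the a at index j. The
    -- wrong sign there would be a shorter bad run, in T^∨ for m even and in T for m odd.
    have hYm : ∀ m ≤ k, (∀ n < m, Y n = .b) → Y m ≠ .b → Y m = if Even m then .a else .av := by
      intro m hm hYb hne
      by_cases hp : Even m
      · rw [if_pos hp]
        cases hv : Y m
        · rfl
        · exact absurd hv hne
        · refine (ih m (by omega) h.check (j := j + 1 + m) ?_ ?_ ?_).elim
          · have : T (j + 1 + m) = .av := by
              rw [← hv, hY, rightOf]; congr 1; ring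
            simp [this, Letter.check]
          · intro n hn
            have := hYb (m - 1 - n) (by omega)
            rw [hY, rightOf] at this
            rw [show j + 1 + (m : ℤ) - 1 - n = j - 1 + 2 + ((m - 1 - n : ℕ) : ℤ) by omega, this]
            rfl
          · rw [show j + 1 + (m : ℤ) - 1 - m = j by ring, hj, if_pos hp]; rfl
      · rw [if_neg hp]
        cases hv : Y m
        · refine (ih m (by omega) h (j := j + 1 + m) ?_ ?_ ?_).elim
          · rw [← hv, hY, rightOf]; congr 1; ring
          · intro n hn
            have := hYb (m - 1 - n) (by omega)
            rw [hY, rightOf] at this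
            rw [show j + 1 + (m : ℤ) - 1 - n = j - 1 + 2 + ((m - 1 - n : ℕ) : ℤ) by omega, this]
          · rw [show j + 1 + (m : ℤ) - 1 - m = j by ring, hj, if_neg hp]
        · exact absurd hv hne
        · rfl
    by_cases hex : ∃ m, m ≤ k ∧ Y m ≠ .b
    · classical
      obtain ⟨hmk, hmne⟩ := Nat.find_spec hex
      have hmin : ∀ n < Nat.find hex, Y n = .b := fun n hn => by
        by_contra hne
        exact Nat.find_min hex hn ⟨by omega, hne⟩
      have hv := hYm _ hmk hmin hmne
      -- At this first index Y carries the extreme letter that makes its value larger, while X still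
      -- has b or the opposite extreme.
      refine value_lt_of_common_b (m := Nat.find hex) (fun n hn => hXb n (by omega)) hmin ?_ ?_
      · intro hp
        rw [hv, if_pos hp]
        rcases hmk.lt_or_eq with hlt | heq
        · rw [hXb _ hlt]; simp [Letter.rank]
        · rw [heq, hXk, if_pos (heq ▸ hp)]; simp [Letter.rank]
      · intro hp
        rw [hv, if_neg hp]
        rcases hmk.lt_or_eq with hlt | heq
        · rw [hXb _ hlt]; simp [Letter.rank]
        · rw [heq, hXk, if_neg (heq ▸ hp)]; simp [Letter.rank]
    · push Not at hex
      refine value_lt_of_common_b (m := k) hXb (fun n hn => hex n hn.le) ?_ ?_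
      · intro hp; rw [hXk, hex k le_rfl, if_pos hp]; simp [Letter.rank]
      · intro hp; rw [hXk, hex k le_rfl, if_neg hp]; simp [Letter.rank]

/-! ### Admissible words as oriented words on {a, b} -/

/-- The effect of a letter on the orientation of the letters after it. -/
def AB.turn : AB → Bool → Bool
  | .a, s => s
  | .b, s => !s

/-- The letter with the given orientation. -/
def AB.toLetter : AB → Bool → Letter
  | .b, _ => .b
  | .a, true => .a
  | .a, false => .av

theorem AB.turn_turn (x : AB) (s : Bool) : x.turn (x.turn s) = s := by
  cases x <;> simp [AB.turn]

theorem AB.turn_not (x : AB) (s : Bool) : x.turn (!s) = !x.turn s := by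
  cases x <;> simp [AB.turn]

theorem AB.toLetter_turn (x : AB) (s : Bool) : x.toLetter (x.turn s) = x.toLetter s := by
  cases x <;> rfl

theorem AB.toLetter_not (x : AB) (s : Bool) : x.toLetter (!s) = (x.toLetter s).check := by
  cases x <;> cases s <;> rfl

theorem exists_turning (S : ℤ → AB) : ∃ ε : ℤ → Bool, ∀ n, ε (n + 1) = (S n).turn (ε n) := by
  -- Each turn is invertible, so the recursion can be run in both directions as integer powers of a
  -- permutation that also carries the index.
  let e : Equiv.Perm (ℤ × Bool) :=
    { toFun := fun p => (p.1 + 1, (S p.1).turn p.2)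
      invFun := fun p => (p.1 - 1, (S (p.1 - 1)).turn p.2)
      left_inv := fun p => by simp [AB.turn_turn]
      right_inv := fun p => by simp [AB.turn_turn] }
  have hstep : ∀ n : ℤ, (e ^ (n + 1)) (0, true) = e ((e ^ n) (0, true)) := fun n => by
    rw [add_comm, zpow_add, zpow_one, Equiv.Perm.mul_apply]
  have hfst : ∀ n : ℤ, ((e ^ n) (0, true)).1 = n := by
    intro n
    induction n using Int.induction_on with
    | zero => simp
    | succ n ih => rw [hstep]; change _ + 1 = _; rw [ih]
    | pred n ih =>
      have h := hstep (-n - 1)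
      rw [sub_add_cancel] at h
      rw [h] at ih
      change _ + 1 = _ at ih
      omega
  refine ⟨fun n => ((e ^ n) (0, true)).2, fun n => ?_⟩
  simp only [hstep]
  change (S _).turn _ = _
  rw [hfst]

/-- `T` is an orientation of the bi-infinite word `S` on `{a, b}`; `ε` records the current
orientation. -/
def IsOrientation (S : ℤ → AB) (ε : ℤ → Bool) (T : ℤ → Letter) : Prop :=
  (∀ n, ε (n + 1) = (S n).turn (ε n)) ∧ ∀ n, T n = (S n).toLetter (ε n)

theorem IsOrientation.check {S : ℤ → AB} {ε : ℤ → Bool} {T : ℤ → Letter}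
    (h : IsOrientation S ε T) : IsOrientation S (fun n => !ε n) fun n => (T n).check :=
  ⟨fun n => by simp only [h.1, AB.turn_not], fun n => by simp only [h.2, AB.toLetter_not]⟩

/-- Forget the signs and choose some orientation ε that flips at each b. Since runs of b obey the
parity rule, ε agrees with the signs of T either at every letter other than b or at none; in the
latter case its negation works. -/
theorem BiAdm.exists_isOrientation {T : ℤ → Letter} (h : BiAdm T) :
    ∃ S ε, IsOrientation S ε T := by
  classical
  let S : ℤ → AB := fun n => if T n = .b then .b else .a
  obtain ⟨ε, hε⟩ := exists_turning S
  have hSa : ∀ n, T n ≠ .b → S n = .a := fun n hn => if_neg hn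
  have hSb : ∀ n, T n = .b → S n = .b := fun n hn => if_pos hn
  have hrun : ∀ (k : ℕ) (p : ℤ), T p ≠ .b → (∀ m : ℕ, m < k → T (p + k - m) = .b) →
      ε (p + k + 1) = if Even k then ε p else !ε p := by
    intro k
    induction k with
    | zero => intro p hp _; simp [hε, hSa p hp, AB.turn]
    | succ k ih =>
      intro p hp hb
      rw [hε, hSb _ (by simpa using hb 0 (by omega)), AB.turn, Nat.cast_succ, ← add_assoc,
        ih p hp fun m hm => by
          rw [← hb (m + 1) (by omega)]; congr 1; push_cast; ring]
      by_cases hp : Even k <;> simp [hp, Nat.even_add_one]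
  -- Agreement of ε with the signs is the same at any two letters other than b: split at an
  -- intermediate such letter, or use `BiAdm.not_bad_run` on a pure run of b's.
  have key : ∀ (d : ℕ) (p : ℤ), T p ≠ .b → T (p + d + 1) ≠ .b →
      ((T p = .a ↔ ε p = true) ↔ (T (p + d + 1) = .a ↔ ε (p + d + 1) = true)) := by
    intro d
    induction d using Nat.strong_induction_on with
    | _ d ih =>
      intro p hp hq
      by_cases hex : ∃ m : ℕ, m < d ∧ T (p + d - m) ≠ .b
      · obtain ⟨m, hm, hne⟩ := hex
        have h1 := ih (d - 1 - m) (by omega) p hp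
        rw [show p + ((d - 1 - m : ℕ) : ℤ) + 1 = p + d - m by omega] at h1
        have h2 := ih m hm (p + d - m) hne
        rw [show p + (d : ℤ) - m + m + 1 = p + d + 1 by ring] at h2
        exact (h1 hne).trans (h2 hq)
      · push Not at hex
        rw [hrun d p hp hex]
        have hbad := fun hj hk => h.not_bad_run d (j := p + d + 1) hj (fun m hm => by
          rw [← hex m hm]; congr 1; ring) hk
        have hbad' := fun hj hk => h.check.not_bad_run d (j := p + d + 1) hj (fun m hm => by
          rw [show p + (d : ℤ) + 1 - 1 - m = p + d - m by ring, hex m hm]; rfl) hk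
        rw [show p + (d : ℤ) + 1 - 1 - d = p by ring] at hbad hbad'
        revert hp hq hbad hbad'
        generalize T (p + d + 1) = y
        generalize T p = x
        generalize ε p = s
        by_cases hd : Even d <;> cases x <;> cases y <;> cases s <;> simp [hd, Letter.check]
  have hor : ∀ δ : ℤ → Bool, (∀ n, δ (n + 1) = (S n).turn (δ n)) →
      (∀ n, T n ≠ .b → (T n = .a ↔ δ n = true)) → IsOrientation S δ T := by
    intro δ hδ hT
    refine ⟨hδ, fun n => ?_⟩
    by_cases hn : T n = .b
    · rw [hSb n hn, hn]; rfl
    · have h1 := hT n hn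
      rw [hSa n hn]
      revert hn h1
      generalize T n = x
      generalize δ n = s
      cases x <;> cases s <;> simp [AB.toLetter]
  by_cases hex : ∃ p, T p ≠ .b
  · obtain ⟨p, hp⟩ := hex
    have hall : ∀ n, T n ≠ .b → ((T p = .a ↔ ε p = true) ↔ (T n = .a ↔ ε n = true)) := by
      intro n hn
      rcases lt_trichotomy p n with hlt | rfl | hlt
      · obtain ⟨d, hd⟩ := Int.exists_add_of_le hlt
        have := key d p hp
        rw [show p + (d : ℤ) + 1 = n by omega] at this
        exact this hn
      · rfl
      · obtain ⟨d, hd⟩ := Int.exists_add_of_le hlt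
        have := key d n hn
        rw [show n + (d : ℤ) + 1 = p by omega] at this
        exact (this hp).symm
    by_cases hg : T p = .a ↔ ε p = true
    · exact ⟨S, ε, hor ε hε fun n hn => (hall n hn).1 hg⟩
    · refine ⟨S, fun n => !ε n, hor _ (fun n => by rw [hε, AB.turn_not]) fun n hn => ?_⟩
      have h1 := mt (hall n hn).2 hg
      rw [Bool.not_eq_true']
      cases hs : ε n
      · simp only [hs, Bool.false_eq_true, iff_false, not_not] at h1
        simp [h1]
      · simp only [hs, iff_true] at h1
        simp [h1]
  · push Not at hex
    exact ⟨S, ε, hor ε hε fun n hn => absurd (hex n) hn⟩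

theorem orient_eq_toLetter {E : ℕ → AB} {δ : ℕ → Bool} (h0 : δ 0 = true)
    (h : ∀ n, δ (n + 1) = (E n).turn (δ n)) (n : ℕ) : orient E n = (E n).toLetter (δ n) := by
  have hδ : δ n = decide (Even ((Finset.range n).filter fun i => E i = .b).card) := by
    induction n with
    | zero => simpa using h0
    | succ n ih =>
      rw [h, ih, Finset.range_add_one, Finset.filter_insert]
      cases hE : E n
      · simp [AB.turn]
      · simp [AB.turn, Nat.even_add_one, -Nat.not_even_iff_odd]
  rw [hδ, orient]
  cases E n
  · by_cases hp : Even ((Finset.range n).filter fun i => E i = .b).card <;> simp [hp, AB.toLetter]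
  · rfl

theorem IsOrientation.rightOf_eq {S : ℤ → AB} {ε : ℤ → Bool} {T : ℤ → Letter}
    (h : IsOrientation S ε T) {c : ℤ} (hc : ε c = true) :
    rightOf T c = orient (rightOf S c) := by
  funext n
  rw [orient_eq_toLetter (δ := rightOf ε c) (by simpa [rightOf] using hc)]
  · exact h.2 _
  · intro n
    simp only [rightOf, Nat.cast_succ, ← add_assoc, h.1]

/-- Turns are involutions, so the same orientation rule holds when reading backwards. -/
theorem IsOrientation.leftOf_eq {S : ℤ → AB} {ε : ℤ → Bool} {T : ℤ → Letter}
    (h : IsOrientation S ε T) {c : ℤ} (hc : ε (c + 1) = true) :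
    leftOf T c = orient (leftOf S c) := by
  funext n
  rw [orient_eq_toLetter (δ := leftOf ε (c + 1)) (by simpa [leftOf] using hc)]
  · simp only [leftOf]
    rw [h.2, show c + 1 - (n : ℤ) = c - n + 1 by ring, h.1, AB.toLetter_turn]
  · intro n
    simp only [leftOf]
    rw [show c + 1 - ((n + 1 : ℕ) : ℤ) = c - n by push_cast; ring,
      show c + 1 - (n : ℤ) = c - n + 1 by ring, h.1, AB.turn_turn]


/-! ### Markoff's property -/

/-- Markoff's property of a bi-infinite word `X^* x y Y` with `{x, y} = {a, b}`: if `X` and `Y`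
differ, then at the first difference the letter of `X` is `y`. -/
def Markoff (S : ℤ → AB) : Prop :=
  ∀ c, S c ≠ S (c + 1) → ∀ i, (∀ j < i, leftOf S (c - 1) j = rightOf S (c + 2) j) →
    leftOf S (c - 1) i ≠ rightOf S (c + 2) i → leftOf S (c - 1) i = S (c + 1)

/-- In every factorization `X^* b a Y` of `S`, the words `X` and `Y` differ before index `N`. -/
def MarkoffBound (N : ℕ) (S : ℤ → AB) : Prop :=
  ∀ c, S c = .b → S (c + 1) = .a → ∃ j < N, leftOf S (c - 1) j ≠ rightOf S (c + 2) j

theorem AB.eq_a_of_ne_b {x : AB} (h : x ≠ .b) : x = .a := by cases x <;> simp_all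

theorem AB.eq_b_of_ne_a {x : AB} (h : x ≠ .a) : x = .b := by cases x <;> simp_all

/-- Orientation true after the b means false before it; the ∨ on the left word restores true, so
both sides become words of the form `orient`. -/
theorem IsOrientation.words_of_b_a {S : ℤ → AB} {ε : ℤ → Bool} {T : ℤ → Letter}
    (h : IsOrientation S ε T) {c : ℤ} (hb : S c = .b) (ha : S (c + 1) = .a)
    (hε : ε (c + 1) = true) :
    (fun n => (leftOf T (c - 1) n).check) = orient (leftOf S (c - 1)) ∧
      rightOf T (c + 2) = orient (rightOf S (c + 2)) := by
  have h1 := h.1 c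
  have h2 := h.1 (c + 1)
  rw [hb, hε] at h1
  rw [ha, hε, show c + 1 + 1 = c + 2 by ring] at h2
  refine ⟨h.check.leftOf_eq (c := c - 1) ?_, h.rightOf_eq h2⟩
  rw [sub_add_cancel]
  simpa [AB.turn] using h1.symm

theorem IsOrientation.words_of_a_b {S : ℤ → AB} {ε : ℤ → Bool} {T : ℤ → Letter}
    (h : IsOrientation S ε T) {c : ℤ} (ha : S c = .a) (hb : S (c + 1) = .b)
    (hε : ε c = true) :
    leftOf T (c - 1) = orient (leftOf S (c - 1)) ∧
      (fun n => (rightOf T (c + 2) n).check) = orient (rightOf S (c + 2)) := by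
  have h1 := h.1 c
  have h2 := h.1 (c + 1)
  rw [ha, hε] at h1
  rw [hb, h1, show c + 1 + 1 = c + 2 by ring] at h2
  refine ⟨h.leftOf_eq (c := c - 1) (by rwa [sub_add_cancel]), h.check.rightOf_eq ?_⟩
  simpa [AB.turn] using h2

/-- A violation at the first difference would, by lexicographic monotonicity, contradict the
comparison of values at that cut. If the orientation there is false, the argument is applied to T^∨.
-/
theorem BiAdm.markoff {S : ℤ → AB} {ε : ℤ → Bool} {T : ℤ → Letter} (hT : BiAdm T)
    (h : IsOrientation S ε T) : Markoff S := by
  intro c hc i hi hne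
  cases hS : S (c + 1)
  · have hb : S c = .b := AB.eq_b_of_ne_a (hS ▸ hc)
    by_contra hl
    have hlb := AB.eq_b_of_ne_a hl
    have hlt := value_orient_lt hi hlb (AB.eq_a_of_ne_b (hlb ▸ hne.symm))
    cases hε : ε (c + 1)
    · obtain ⟨e1, e2⟩ := h.check.words_of_b_a hb hS (by simp [hε])
      rw [← e1, ← e2] at hlt
      exact hlt.not_ge (hT.2.right_le_left (by simp [hb, Letter.check, h.2, AB.toLetter])
        (by simp [h.2, hS, hε, AB.toLetter, Letter.check]))
    · obtain ⟨e1, e2⟩ := h.words_of_b_a hb hS hε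
      rw [← e1, ← e2] at hlt
      exact hlt.not_ge (hT.1.right_le_left (by simp [hb, h.2, AB.toLetter])
        (by simp [h.2, hS, hε, AB.toLetter]))
  · have ha : S c = .a := AB.eq_a_of_ne_b (hS ▸ hc)
    by_contra hl
    have hla := AB.eq_a_of_ne_b hl
    have hlt := value_orient_lt (fun j hj => (hi j hj).symm)
      (AB.eq_b_of_ne_a (hla ▸ hne.symm)) hla
    cases hε : ε c
    · obtain ⟨e1, e2⟩ := h.check.words_of_a_b ha hS (by simp [hε])
      rw [← e1, ← e2] at hlt
      exact hlt.not_ge (hT.check.2.left_le_right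
        (by simp [ha, hε, Letter.check, h.2, AB.toLetter])
        (by simp [h.2, hS, AB.toLetter, Letter.check]))
    · obtain ⟨e1, e2⟩ := h.words_of_a_b ha hS hε
      rw [← e1, ← e2] at hlt
      exact hlt.not_ge (hT.2.left_le_right (by simp [ha, hε, h.2, AB.toLetter])
        (by simp [h.2, hS, AB.toLetter]))

theorem exists_ne_of_lam_lt {B : BiWord Letter} {T : ℤ → Letter} (hT : B.IsSection T) {N : ℕ}
    (hN : lam B < N) {c : ℤ} (hb : T c = .b) (ha : T (c + 1) = .a) :
    ∃ j < N, (leftOf T (c - 1) j).check ≠ rightOf T (c + 2) j := by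
  by_contra! hall
  have hocc := (occurs_iff B (List.ofFn fun i : Fin N => rightOf T (c + 2) i)).2
    ⟨_, hT.shift c, by simpa using hb, by simpa [add_comm] using ha, fun n hn => by
      rw [List.length_ofFn] at hn
      have h1 := hall n hn
      rw [List.getElem_ofFn, ← h1, Letter.check_check, h1]
      refine ⟨?_, ?_⟩
      · simp only [rightOf]; congr 1; ring
      · simp only [leftOf]; congr 1; ring⟩
  refine hN.not_ge (le_iSup_of_le _ (le_iSup_of_le hocc ?_))
  simp

theorem orient_congr {E F : ℕ → AB} {n : ℕ} (h : ∀ k ≤ n, E k = F k) : orient E n = orient F n := by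
  have hc : ((Finset.range n).filter fun i => E i = .b)
      = (Finset.range n).filter fun i => F i = .b :=
    Finset.filter_congr fun i hi => by rw [h i (Finset.mem_range.mp hi).le]
  rw [orient, orient, hc, h n le_rfl]

theorem markoffBound_of_lam_lt {B : BiWord Letter} {S : ℤ → AB} {ε : ℤ → Bool} {T : ℤ → Letter}
    (hT : B.IsSection T) (h : IsOrientation S ε T) {N : ℕ} (hN : lam B < N)
    (hN' : lam B.check < N) : MarkoffBound N S := by
  intro c hb ha
  by_contra! hall
  cases hε : ε (c + 1)
  · obtain ⟨e1, e2⟩ := h.check.words_of_b_a hb ha (by simp [hε])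
    obtain ⟨j, hj, hne⟩ := exists_ne_of_lam_lt hT.check hN' (c := c)
      (by simp [hb, Letter.check, h.2, AB.toLetter])
      (by simp [h.2, ha, hε, AB.toLetter, Letter.check])
    exact hne ((congrFun e1 j).trans ((orient_congr fun k hk => hall k (by omega)).trans
      (congrFun e2 j).symm))
  · obtain ⟨e1, e2⟩ := h.words_of_b_a hb ha hε
    obtain ⟨j, hj, hne⟩ := exists_ne_of_lam_lt hT hN (c := c) (by simp [hb, h.2, AB.toLetter])
      (by simp [h.2, ha, hε, AB.toLetter])
    exact hne ((congrFun e1 j).trans ((orient_congr fun k hk => hall k (by omega)).trans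
      (congrFun e2 j).symm))


/-- A bi-infinite word with Markoff's property does not contain both `a a` and `b b`. -/
theorem Markoff.not_two_doubles {S : ℤ → AB} (hS : Markoff S) (d : ℕ) (i : ℤ)
    (hi : S i = S (i + 1)) (hd : S (i + d) = S (i + d + 1)) : S i = S (i + d) := by
  induction d using Nat.strong_induction_on generalizing i with
  | _ d ih =>
    by_contra hne
    have two : ∀ {x y z : AB}, x ≠ y → y ≠ z → x = z := by
      intro x y z; cases x <;> cases y <;> cases z <;> simp
    have halt : ∀ m : ℕ, 0 < m → m < d → S (i + m) ≠ S (i + m + 1) := by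
      intro m h0 h1 heq
      have e1 := ih m h1 i hi heq
      have e2 := ih (d - m) (by omega) (i + m) heq (by
        rw [show i + (m : ℤ) + ((d - m : ℕ) : ℤ) = i + d by omega]; exact hd)
      rw [show i + (m : ℤ) + ((d - m : ℕ) : ℤ) = i + d by omega] at e2
      exact hne (e1.trans e2)
    -- Write x = S i and y = S (i + d). By minimality of d no double lies in between, so the word
    -- reads x x y x y … x y y.
    have hpar : ∀ m : ℕ, m < d → S (i + m + 1) = if Even m then S i else S (i + d) := by
      intro m
      induction m with
      | zero => intro _; simp [hi]
      | succ m ihm =>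
        intro hm
        have h1 := halt (m + 1) (by omega) hm
        have h2 := ihm (by omega)
        rw [show i + ((m + 1 : ℕ) : ℤ) = i + m + 1 by push_cast; ring] at h1 ⊢
        rw [h2] at h1
        by_cases hp : Even m
        · rw [if_pos hp] at h1
          simp only [Nat.even_add_one, hp, not_true_eq_false, if_false]
          exact two h1.symm hne
        · rw [if_neg hp] at h1
          simp only [Nat.even_add_one, hp, not_false_eq_true, if_true]
          exact two h1.symm (Ne.symm hne)
    rcases d with _ | _ | d
    · simp at hne
    · exact hne (by simpa using hi)
    have hdev : Even d := by
      have h := hpar (d + 1) (by omega)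
      by_contra hp
      rw [show i + ((d + 1 : ℕ) : ℤ) + 1 = i + ((d + 1 + 1 : ℕ) : ℤ) by push_cast; ring,
        if_pos (by simp [Nat.even_add_one, hp])] at h
      exact hne h.symm
    have hY : ∀ m < d, rightOf S (i + 1 + 2) m
        = if Even m then S i else S (i + ((d + 1 + 1 : ℕ) : ℤ)) := by
      intro m hm
      have h := hpar (m + 2) (by omega)
      simp only [Nat.even_add, even_two, iff_true] at h
      rw [← h, rightOf]; congr 1; push_cast; ring
    have hYd : ∀ m, d - 1 ≤ m → m ≤ d →
        rightOf S (i + 1 + 2) m = S (i + ((d + 1 + 1 : ℕ) : ℤ)) := by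
      intro m h1 h2
      rcases h2.lt_or_eq with h3 | rfl
      · rw [hY m h3, if_neg]
        obtain ⟨k, hk⟩ := hdev
        rintro ⟨l, hl⟩
        omega
      · rw [hd, rightOf]; congr 1; push_cast; ring
    -- Cut after the second x, between x and y. To the right of the cut pair stands x y x y … y y,
    -- and a first difference must put y on the left side.
    have hM := hS (i + 1) (by simpa using halt 1 (by omega) (by omega))
    have hc2 : S (i + 1 + 1) = S (i + ((d + 1 + 1 : ℕ) : ℤ)) := by
      simpa using hpar 1 (by omega)
    rw [hc2, add_sub_cancel_right] at hM
    have hXpair : ∀ m : ℕ, 0 < m → m ≤ d → leftOf S i m = S (i + ((d + 1 + 1 : ℕ) : ℤ)) →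
        leftOf S i (m - 1) = S (i + ((d + 1 + 1 : ℕ) : ℤ)) → False := by
      intro m h0 h1 e1 e2
      simp only [leftOf] at e1 e2
      rw [show i - ((m - 1 : ℕ) : ℤ) = i - m + 1 by omega] at e2
      have := ih m (by omega) (i - m) (e1.trans e2.symm) (by simpa using hi)
      rw [e1, sub_add_cancel] at this
      exact hne this.symm
    -- A first difference would place y at an even position of the left word, after a y copied from
    -- the right: a double y closer to x x. With no difference, the final y y itself is copied to
    -- the left, again too close.
    have hX : ∀ m ≤ d, leftOf S i m = rightOf S (i + 1 + 2) m := by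
      intro m
      induction m using Nat.strong_induction_on with
      | _ m ihm =>
        intro hm
        by_contra hne'
        have e := hM m (fun j hj => ihm j hj (by omega)) hne'
        rw [e] at hne'
        rcases Nat.eq_zero_or_pos m with rfl | h0
        · exact hne (by simpa [leftOf] using e)
        · refine hXpair m h0 hm e ?_
          rcases hm.lt_or_eq with hlt | rfl
          · rw [hY m hlt] at hne'
            have hev : Even m := by
              by_contra hp
              rw [if_neg hp] at hne'
              exact hne' rfl
            rw [ihm (m - 1) (by omega) (by omega), hY _ (by omega), if_neg]
            obtain ⟨k, hk⟩ := hev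
            rintro ⟨l, hl⟩
            omega
          · exact absurd (hYd m (by omega) le_rfl).symm hne'
    rcases Nat.eq_zero_or_pos d with rfl | h0
    · have h1 := hX 0 le_rfl
      rw [hYd 0 (by omega) le_rfl] at h1
      exact hne (by simpa [leftOf] using h1)
    · exact hXpair d h0 le_rfl ((hX d le_rfl).trans (hYd d (by omega) le_rfl))
        ((hX (d - 1) (by omega)).trans (hYd (d - 1) le_rfl (by omega)))

/-! ### Mechanical words and the symmetry exchanging a and b -/

/-- `S` is a bi-infinite mechanical word of rational slope: the frequency of `b` is `p / q`. -/
def IsMechanical (S : ℤ → AB) : Prop :=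
  ∃ p q r : ℤ, 0 < q ∧ 0 ≤ p ∧ p ≤ q ∧ IsCoprime p q ∧ ∀ n, S n = .b ↔ q - p ≤ (p * n + r) % q

/-- Exchange of the letters `a` and `b`. -/
def AB.swap : AB → AB
  | .a => .b
  | .b => .a

theorem AB.swap_inj {x y : AB} : x.swap = y.swap ↔ x = y := by
  cases x <;> cases y <;> simp [AB.swap]

/-- The reversal of `S` with the letters exchanged. -/
def swapReverse (S : ℤ → AB) : ℤ → AB := fun n => (S (-n)).swap

theorem swapReverse_swapReverse (S : ℤ → AB) : swapReverse (swapReverse S) = S := by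
  funext n
  simp only [swapReverse, neg_neg]
  cases S n <;> rfl

theorem leftOf_swapReverse (S : ℤ → AB) (c : ℤ) (n : ℕ) :
    leftOf (swapReverse S) c n = (rightOf S (-c) n).swap := by
  simp only [leftOf, swapReverse, rightOf]; congr 2; ring

theorem rightOf_swapReverse (S : ℤ → AB) (c : ℤ) (n : ℕ) :
    rightOf (swapReverse S) c n = (leftOf S (-c) n).swap := by
  simp only [leftOf, swapReverse, rightOf]; congr 2; ring

theorem Markoff.swapReverse {S : ℤ → AB} (hS : Markoff S) : Markoff (swapReverse S) := by
  intro c hc i hi hne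
  have hc' : S (-c - 1) ≠ S (-c - 1 + 1) := by
    intro h
    refine hc (AB.swap_inj.mpr ?_)
    rw [neg_add, ← sub_eq_add_neg, h, sub_add_cancel]
  have e1 : -(c - 1) = -c - 1 + 2 := by ring
  have e2 : -(c + 2) = -c - 1 - 1 := by ring
  have e3 : -(c + 1) = -c - 1 := by ring
  simp only [leftOf_swapReverse, rightOf_swapReverse, AB.swap_inj, e1, e2, ne_eq] at hi hne ⊢
  have h := hS (-c - 1) hc' i (fun j hj => (hi j hj).symm) (Ne.symm hne)
  rw [Romik.swapReverse, AB.swap_inj, e3]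
  revert h hne hc'
  generalize S (-c - 1) = x
  generalize S (-c - 1 + 1) = y
  generalize leftOf S (-c - 1 - 1) i = z
  generalize rightOf S (-c - 1 + 2) i = t
  cases x <;> cases y <;> cases z <;> cases t <;> simp

/-- Exchange turns b a into a b and reversal turns it back, which is why the two are combined. -/
theorem MarkoffBound.swapReverse {S : ℤ → AB} {N : ℕ} (hS : MarkoffBound N S) :
    MarkoffBound N (swapReverse S) := by
  intro c hb ha
  have hsb : ∀ {x : AB}, x.swap = .b → x = .a := by intro x; cases x <;> simp [AB.swap]
  have hsa : ∀ {x : AB}, x.swap = .a → x = .b := by intro x; cases x <;> simp [AB.swap]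
  have e1 : -(c - 1) = -c - 1 + 2 := by ring
  have e2 : -(c + 2) = -c - 1 - 1 := by ring
  have e3 : -(c + 1) = -c - 1 := by ring
  obtain ⟨j, hj, hne⟩ := hS (-c - 1) (by rw [← e3]; exact hsa ha) (by
    rw [sub_add_cancel]; exact hsb hb)
  refine ⟨j, hj, ?_⟩
  simp only [leftOf_swapReverse, rightOf_swapReverse, ne_eq, AB.swap_inj, e1, e2]
  exact Ne.symm hne

theorem IsMechanical.swapReverse {S : ℤ → AB} (hS : IsMechanical S) :
    IsMechanical (swapReverse S) := by
  obtain ⟨p, q, r, hq, hp, hpq, hco, h⟩ := hS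
  -- The shift by q − p moves the old residues below q − p, which mark the letter a, to the top of
  -- the range.
  refine ⟨q - p, q, r - (q - p), hq, by linarith, by linarith, ?_, fun n => ?_⟩
  · obtain ⟨u, v, huv⟩ := hco
    exact ⟨-u, u + v, by linear_combination huv⟩
  · have h1 : Romik.swapReverse S n = .b ↔ ¬S (-n) = .b := by
      rw [Romik.swapReverse]; cases S (-n) <;> simp [AB.swap]
    rw [h1, h]
    have h3 := Int.emod_nonneg (p * -n + r) hq.ne'
    have h4 := Int.emod_lt_of_pos (p * -n + r) hq
    have h5 := Int.emod_add_mul_ediv (p * -n + r) q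
    generalize (p * -n + r) % q = x at *
    generalize (p * -n + r) / q = y at *
    rcases lt_or_ge x (q - p) with hx | hx
    · have h2 : ((q - p) * n + (r - (q - p))) % q = x - (q - p) + q := by
        rw [show (q - p) * n + (r - (q - p)) = x - (q - p) + q + q * (n + y - 1) by
          linear_combination -h5, Int.add_mul_emod_self_left]
        exact Int.emod_eq_of_lt (by omega) (by omega)
      rw [h2]; omega
    · have h2 : ((q - p) * n + (r - (q - p))) % q = x - (q - p) := by
        rw [show (q - p) * n + (r - (q - p)) = x - (q - p) + q * (n + y) by
          linear_combination -h5, Int.add_mul_emod_self_left]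
        exact Int.emod_eq_of_lt (by omega) (by omega)
      rw [h2]; omega


/-! ### Desubstitution by a ↦ a, b ↦ ab -/

/-- The length of the image of a letter under the substitution `a ↦ a`, `b ↦ a b`. -/
def AB.blockLength : AB → ℤ
  | .a => 1
  | .b => 2

/-- `S` is the image of `S'` under the substitution `a ↦ a`, `b ↦ a b`, and `f k` is the position
at which the image of the letter with index `k` starts. -/
structure IsSubstitution (S S' : ℤ → AB) (f : ℤ → ℤ) : Prop where
  start : ∀ k, S (f k) = .a
  next : ∀ k, S (f k + 1) = S' k
  succ : ∀ k, f (k + 1) = f k + (S' k).blockLength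

theorem exists_isSubstitution {S : ℤ → AB} (hbb : ∀ n, S n = .b → S (n + 1) = .a)
    (ha : ∃ n, S n = .a) : ∃ S' f, IsSubstitution S S' f := by
  obtain ⟨n₀, hn₀⟩ := ha
  have hbb' : ∀ n, S n = .b → S (n - 1) = .a := fun n hn => by
    by_contra h
    have := hbb _ (AB.eq_b_of_ne_a h)
    rw [sub_add_cancel, hn] at this
    cases this
  -- Without bb, each block a or ab starts at an a; this permutation moves to the next a, and its
  -- powers enumerate all block starts used.
  let e : Equiv.Perm {n // S n = .a} :=
    { toFun := fun n => if h : S (n.1 + 1) = .a then ⟨n.1 + 1, h⟩ else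
        ⟨n.1 + 2, by
          have := hbb _ (AB.eq_b_of_ne_a h)
          rwa [show n.1 + 1 + 1 = n.1 + 2 by ring] at this⟩
      invFun := fun n => if h : S (n.1 - 1) = .a then ⟨n.1 - 1, h⟩ else
        ⟨n.1 - 2, by
          have := hbb' _ (AB.eq_b_of_ne_a h)
          rwa [show n.1 - 1 - 1 = n.1 - 2 by ring] at this⟩
      left_inv := fun n => by
        by_cases h : S (n.1 + 1) = .a
        · simp [h, n.2]
        · simp [h, show n.1 + 2 - 1 = n.1 + 1 by ring]
      right_inv := fun n => by
        by_cases h : S (n.1 - 1) = .a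
        · simp [h, n.2]
        · simp [h, show n.1 - 2 + 1 = n.1 - 1 by ring] }
  let f : ℤ → ℤ := fun k => ((e ^ k) ⟨n₀, hn₀⟩).1
  refine ⟨fun k => S (f k + 1), f, fun k => ((e ^ k) ⟨n₀, hn₀⟩).2, fun k => rfl, fun k => ?_⟩
  have h1 : f (k + 1) = (e ((e ^ k) ⟨n₀, hn₀⟩)).1 := by
    simp only [f]
    rw [add_comm, zpow_add, zpow_one, Equiv.Perm.mul_apply]
  rw [h1]
  change (dite _ _ _ : {n // S n = .a}).1 = _
  by_cases h : S (((e ^ k) ⟨n₀, hn₀⟩).1 + 1) = .a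
  · rw [dif_pos h]
    simp only [f, h, AB.blockLength]
  · rw [dif_neg h]
    simp only [f, AB.eq_b_of_ne_a h, AB.blockLength]

namespace IsSubstitution

variable {S S' : ℤ → AB} {f : ℤ → ℤ}

/-- The image of each letter ends with that letter. -/
theorem prev (h : IsSubstitution S S' f) (k : ℤ) : S (f k - 1) = S' (k - 1) := by
  have h1 := h.succ (k - 1)
  rw [sub_add_cancel] at h1
  cases hk : S' (k - 1)
  · rw [hk, AB.blockLength] at h1
    rw [h1, add_sub_cancel_right, h.start]
  · rw [hk, AB.blockLength] at h1
    rw [h1, ← hk, ← h.next]; congr 1; ring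

/-- Mirrored agreement in S' lifts to S: a block starts with a and ends with its own letter, so,
after the shared initial a, each common letter prolongs the agreement by a or by b a on both sides.
Counting that initial a there are L + 1 > i common letters. -/
theorem reflect (h : IsSubstitution S S' f) {c d : ℤ} {i : ℕ}
    (hi : ∀ j < i, leftOf S' (c - 1) j = rightOf S' d j) :
    ∃ L : ℕ, i ≤ L ∧ f (c - i) = f c - L ∧ f (d + i) = f d + L ∧
      ∀ j ≤ L, leftOf S (f c) j = rightOf S (f d) j := by
  induction i with
  | zero =>
    refine ⟨0, le_rfl, by simp, by simp, fun j hj => ?_⟩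
    rw [Nat.le_zero.mp hj]
    simp [leftOf, rightOf, h.start]
  | succ i ih =>
    obtain ⟨L, hL, h1, h2, h3⟩ := ih fun j hj => hi j (by omega)
    have hl := h.prev (c - i)
    have hr := h.next (d + i)
    have h4 := h.succ (c - i - 1)
    have h5 := h.succ (d + i)
    have h6 := hi i (by omega)
    have h7 := h.start (c - i - 1)
    have h8 := h.start (d + i + 1)
    simp only [leftOf, rightOf] at h6 h3 ⊢
    rw [show c - 1 - (i : ℤ) = c - i - 1 by ring] at h6
    rw [sub_add_cancel, h6] at h4
    rw [h6, ← hr, h1, h2] at hl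
    rw [h1] at h4
    rw [h2] at h5
    rw [show c - ((i + 1 : ℕ) : ℤ) = c - i - 1 by push_cast; ring,
      show d + ((i + 1 : ℕ) : ℤ) = d + i + 1 by push_cast; ring]
    cases hx : S' (d + i) <;> rw [hx, AB.blockLength] at h4 h5
    · refine ⟨L + 1, by omega, by push_cast; omega, by push_cast; omega, fun j hj => ?_⟩
      rcases Nat.lt_or_ge L j with hj' | hj'
      · obtain rfl : j = L + 1 := by omega
        convert hl using 2 <;> push_cast <;> ring
      · exact h3 j hj'
    · refine ⟨L + 2, by omega, by push_cast; omega, by push_cast; omega, fun j hj => ?_⟩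
      rcases Nat.lt_or_ge L j with hj' | hj'
      · rcases Nat.lt_or_ge (L + 1) j with hj'' | hj''
        · obtain rfl : j = L + 2 := by omega
          rw [show f c - ((L + 2 : ℕ) : ℤ) = f (c - i - 1) by push_cast; omega,
            show f d + ((L + 2 : ℕ) : ℤ) = f (d + i + 1) by push_cast; omega, h7, h8]
        · obtain rfl : j = L + 1 := by omega
          convert hl using 2 <;> push_cast <;> ring
      · exact h3 j hj'

/-- The images of ab and ba are aab and aba: the same pair again, after one extra a that joins the
left side. -/
theorem cut (h : IsSubstitution S S' f) {c : ℤ} (hc : S' c ≠ S' (c + 1)) :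
    S (f c + 1) = S' c ∧ S (f c + 1 + 1) = S' (c + 1) ∧ f c + 1 + 2 = f (c + 2) := by
  have h1 := h.next c
  have h2 := h.next (c + 1)
  have h3 := h.succ c
  have h4 := h.succ (c + 1)
  have h5 := h.start (c + 1)
  rw [show c + 1 + 1 = c + 2 by ring] at h4
  refine ⟨h1, ?_, ?_⟩
  · cases hx : S' c
    · rw [hx, AB.blockLength] at h3
      rw [← h3, h2]
    · rw [hx, AB.blockLength] at h3
      rw [hx] at hc
      rw [AB.eq_a_of_ne_b hc.symm, ← h5, h3]; congr 1; ring
  · cases hx : S' c <;> cases hy : S' (c + 1) <;> simp only [hx, hy, AB.blockLength] at h3 h4 hc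
    · exact absurd rfl hc
    · omega
    · omega
    · exact absurd rfl hc

theorem markoff (h : IsSubstitution S S' f) (hS : Markoff S) : Markoff S' := by
  intro c hc i hi hne
  obtain ⟨h1, h2, h3⟩ := h.cut hc
  obtain ⟨L, -, h4, h5, h6⟩ := h.reflect hi
  have hM := hS (f c + 1) (by rwa [h1, h2]) (L + 1)
  rw [add_sub_cancel_right, h3, h2] at hM
  have e1 : leftOf S (f c) (L + 1) = leftOf S' (c - 1) i := by
    simp only [leftOf]
    rw [show f c - ((L + 1 : ℕ) : ℤ) = f (c - i) - 1 by push_cast; omega, h.prev]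
    congr 1; ring
  have e2 : rightOf S (f (c + 2)) (L + 1) = rightOf S' (c + 2) i := by
    simp only [rightOf]
    rw [show f (c + 2) + ((L + 1 : ℕ) : ℤ) = f (c + 2 + i) + 1 by push_cast; omega, h.next]
  rw [e1, e2] at hM
  exact hM (fun j hj => h6 j (by omega)) hne

/-- The extra common letter in `reflect` makes the bound drop, so the descent terminates. -/
theorem markoffBound (h : IsSubstitution S S' f) {N : ℕ} (hS : MarkoffBound (N + 1) S) :
    MarkoffBound N S' := by
  intro c hb ha
  by_contra! hall
  obtain ⟨h1, h2, h3⟩ := h.cut (c := c) (by simp [ha, hb])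
  obtain ⟨L, hL, -, -, h6⟩ := h.reflect hall
  obtain ⟨j, hj, hne⟩ := hS (f c + 1) (h1.trans hb) (h2.trans ha)
  rw [add_sub_cancel_right, h3] at hne
  exact hne (h6 j (by omega))

theorem cover (h : IsSubstitution S S' f) (n : ℤ) : ∃ k, n = f k ∨ n = f k + 1 ∧ S' k = .b := by
  have up : ∀ n, (∃ k, n = f k ∨ n = f k + 1 ∧ S' k = .b) →
      ∃ k, n + 1 = f k ∨ n + 1 = f k + 1 ∧ S' k = .b := by
    rintro n ⟨k, rfl | ⟨rfl, hk⟩⟩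
    · cases hk : S' k
      · exact ⟨k + 1, Or.inl (by rw [h.succ, hk]; rfl)⟩
      · exact ⟨k, Or.inr ⟨rfl, hk⟩⟩
    · exact ⟨k + 1, Or.inl (by rw [h.succ, hk, AB.blockLength]; ring)⟩
  have down : ∀ n, (∃ k, n = f k ∨ n = f k + 1 ∧ S' k = .b) →
      ∃ k, n - 1 = f k ∨ n - 1 = f k + 1 ∧ S' k = .b := by
    rintro n ⟨k, rfl | ⟨rfl, hk⟩⟩
    · have h1 := h.succ (k - 1)
      rw [sub_add_cancel] at h1
      cases hk : S' (k - 1) <;> rw [hk, AB.blockLength] at h1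
      · exact ⟨k - 1, Or.inl (by omega)⟩
      · exact ⟨k - 1, Or.inr ⟨by omega, hk⟩⟩
    · exact ⟨k, Or.inl (by ring)⟩
  have key : ∀ m : ℤ, ∃ k, f 0 + m = f k ∨ f 0 + m = f k + 1 ∧ S' k = .b := by
    intro m
    induction m using Int.induction_on with
    | zero => exact ⟨0, Or.inl (by simp)⟩
    | succ m ih => rw [← add_assoc]; exact up _ ih
    | pred m ih => rw [← add_sub_assoc]; exact down _ ih
  simpa using key (n - f 0)

/-- Up to a constant, f k is k plus the number ⌊(pk + r)/q⌋ counting b's. With modulus p + q the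
residue at f k is then the old residue at k, below q, and at the b of a block it is larger by p. The
slope p/q becomes p/(p + q). -/
theorem isMechanical (h : IsSubstitution S S' f) (hS : IsMechanical S') : IsMechanical S := by
  obtain ⟨p, q, r, hq, hp, hpq, hco, hb⟩ := hS
  have hstep : ∀ k, f (k + 1) - (k + 1 + (p * (k + 1) + r) / q) = f k - (k + (p * k + r) / q) := by
    intro k
    have h1 := Int.emod_nonneg (p * k + r) hq.ne'
    have h2 := Int.emod_lt_of_pos (p * k + r) hq
    have h3 := Int.emod_add_mul_ediv (p * k + r) q
    have h4 := hb k
    have h5 := h.succ k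
    generalize (p * k + r) % q = x at *
    generalize (p * k + r) / q = y at *
    cases hk : S' k
    · have h6 : (p * (k + 1) + r) / q = y := by
        rw [show p * (k + 1) + r = x + p + q * y by linear_combination -h3,
          Int.add_mul_ediv_left _ _ hq.ne', Int.ediv_eq_zero_of_lt (by omega) (by
            simp only [hk, reduceCtorEq, false_iff] at h4; omega)]
        ring
      rw [h6, h5, hk, AB.blockLength]; ring
    · have h6 : (p * (k + 1) + r) / q = y + 1 := by
        rw [show p * (k + 1) + r = x + p - q + q * (y + 1) by linear_combination -h3,
          Int.add_mul_ediv_left _ _ hq.ne', Int.ediv_eq_zero_of_lt (by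
            simp only [hk, true_iff] at h4; omega) (by omega)]
        ring
      rw [h6, h5, hk, AB.blockLength]; ring
  have hf : ∀ k, f k - (k + (p * k + r) / q) = f 0 - (0 + (p * 0 + r) / q) := by
    intro k
    induction k using Int.induction_on with
    | zero => rfl
    | succ k ih => rw [hstep, ih]
    | pred k ih => rw [← hstep, sub_add_cancel, ih]
  generalize f 0 - (0 + (p * 0 + r) / q) = s at hf
  refine ⟨p, p + q, r - p * s, by omega, hp, by omega, ?_, fun n => ?_⟩
  · obtain ⟨u, v, huv⟩ := hco
    exact ⟨u - v, v, by linear_combination huv⟩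
  obtain ⟨k, hk⟩ := h.cover n
  have h1 := Int.emod_nonneg (p * k + r) hq.ne'
  have h2 := Int.emod_lt_of_pos (p * k + r) hq
  have h3 := Int.emod_add_mul_ediv (p * k + r) q
  have h4 := hb k
  have h5 := hf k
  generalize (p * k + r) % q = x at *
  generalize (p * k + r) / q = y at *
  have h6 : f k = k + y + s := by omega
  rcases hk with rfl | ⟨rfl, hk⟩
  · have h7 : (p * f k + (r - p * s)) % (p + q) = x := by
      rw [show p * f k + (r - p * s) = x + (p + q) * y by rw [h6]; linear_combination -h3,
        Int.add_mul_emod_self_left, Int.emod_eq_of_lt h1 (by omega)]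
    rw [h7, h.start]
    simp only [reduceCtorEq, false_iff]
    omega
  · rw [hk] at h4
    simp only [true_iff] at h4
    have h7 : (p * (f k + 1) + (r - p * s)) % (p + q) = x + p := by
      rw [show p * (f k + 1) + (r - p * s) = x + p + (p + q) * y by
        rw [h6]; linear_combination -h3,
        Int.add_mul_emod_self_left, Int.emod_eq_of_lt (by omega) (by omega)]
    rw [h7, h.next, hk]
    simp only [true_iff]
    omega

end IsSubstitution

theorem isMechanical_of_const {S : ℤ → AB} {x : AB} (h : ∀ n, S n = x) : IsMechanical S := by
  cases x
  · exact ⟨0, 1, 0, by norm_num, by norm_num, by norm_num, isCoprime_one_right, fun n => by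
      simp [h]⟩
  · exact ⟨1, 1, 0, by norm_num, by norm_num, by norm_num, isCoprime_one_right, fun n => by
      simp [h]⟩

theorem eq_of_forall_eq_succ {S : ℤ → AB} (h : ∀ n, S n = S (n + 1)) (n : ℤ) : S n = S 0 := by
  induction n using Int.induction_on with
  | zero => rfl
  | succ n ih => rw [← h, ih]
  | pred n ih => rw [h, sub_add_cancel, ih]

/-- A bi-infinite word with Markoff's property whose factors `w^* b a w` have bounded length is
mechanical of rational slope. -/
theorem Markoff.isMechanical {N : ℕ} {S : ℤ → AB} (hS : Markoff S) (hN : MarkoffBound N S) :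
    IsMechanical S := by
  induction N generalizing S with
  | zero =>
    have hba : ∀ c, S c = .b → S (c + 1) = .b := fun c hb => by
      by_contra h
      obtain ⟨j, hj, -⟩ := hN c hb (AB.eq_a_of_ne_b h)
      omega
    refine isMechanical_of_const (x := S 0) (eq_of_forall_eq_succ fun c => ?_)
    by_contra hc
    have h1 : S c = .a := AB.eq_a_of_ne_b fun hb => hc (hb.trans (hba c hb).symm)
    have h2 : S (c + 1) = .b := AB.eq_b_of_ne_a fun ha => hc (h1.trans ha.symm)
    have h3 : S (c - 1) = .a := AB.eq_a_of_ne_b fun hb => by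
      have := hba _ hb
      rw [sub_add_cancel, h1] at this
      cases this
    have h4 : S (c + 2) = .b := by
      have := hba _ h2
      rwa [show c + 1 + 1 = c + 2 by ring] at this
    -- Without b a, a nonconstant word contains a a b b around its change from a to b, which
    -- violates Markoff's property at index 0.
    have := hS c hc 0 (by simp) (by simp [leftOf, rightOf, h3, h4])
    simp [leftOf, h3, h2] at this
  | succ N ih =>
    have main : ∀ {S : ℤ → AB}, Markoff S → MarkoffBound (N + 1) S →
        (∀ n, S n = .b → S (n + 1) = .a) → IsMechanical S := by
      intro S hS hN hbb
      have ha : ∃ n, S n = .a := by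
        by_contra! h
        exact h _ (hbb 0 (AB.eq_b_of_ne_a (h 0)))
      obtain ⟨S', f, h⟩ := exists_isSubstitution hbb ha
      exact h.isMechanical (ih (h.markoff hS) (h.markoffBound hN))
    by_cases hbb : ∀ n, S n = .b → S (n + 1) = .a
    · exact main hS hN hbb
    · push Not at hbb
      obtain ⟨j, hj, hj'⟩ := hbb
      have hj' := AB.eq_b_of_ne_a hj'
      have haa : ∀ n, S n = .a → S (n + 1) = .b := by
        intro i hi
        by_contra hi'
        have hi' := AB.eq_a_of_ne_b hi'
        rcases le_total i j with hij | hij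
        · obtain ⟨d, rfl⟩ := Int.le.dest hij
          have := hS.not_two_doubles d i (hi.trans hi'.symm) (hj.trans hj'.symm)
          rw [hi, hj] at this
          cases this
        · obtain ⟨d, rfl⟩ := Int.le.dest hij
          have := hS.not_two_doubles d j (hj.trans hj'.symm) (hi.trans hi'.symm)
          rw [hi, hj] at this
          cases this
      -- Since bb occurs, aa does not; reversal with exchange leads back to a word without bb.
      rw [← swapReverse_swapReverse S]
      refine (main hS.swapReverse hN.swapReverse fun n hn => ?_).swapReverse
      by_contra hne
      have h1 := AB.eq_b_of_ne_a hne
      have hsb : ∀ {x : AB}, x.swap = .b → x = .a := by intro x; cases x <;> simp [AB.swap]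
      have h2 := haa _ (hsb h1)
      rw [show -(n + 1) + 1 = -n by ring, hsb hn] at h2
      cases h2


/-! ### Christoffel words as periods of mechanical words -/

/-- The letters of the bi-infinite mechanical word of slope `t / s`. -/
def mechanicalLetter (s t : ℕ) (i : ℤ) : AB :=
  if (s : ℤ) ≤ (t * i) % (s + t : ℕ) then .b else .a

/-- The first `n` letters of the mechanical word of slope `t / s`. -/
def mechanicalPrefix (s t n : ℕ) : List AB :=
  (List.range n).map fun i : ℕ => mechanicalLetter s t i

theorem length_mechanicalPrefix (s t n : ℕ) : (mechanicalPrefix s t n).length = n := by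
  simp [mechanicalPrefix]

theorem take_mechanicalPrefix (s t : ℕ) {i n : ℕ} (h : i ≤ n) :
    (mechanicalPrefix s t n).take i = mechanicalPrefix s t i := by
  rw [mechanicalPrefix, ← List.map_take, List.take_range, min_eq_left h, mechanicalPrefix]

theorem count_mechanicalPrefix (s t n : ℕ) (h : 0 < s + t) :
    (mechanicalPrefix s t n).count .b = t * n / (s + t) ∧
      (mechanicalPrefix s t n).count .a + t * n / (s + t) = n := by
  induction n with
  | zero => simp [mechanicalPrefix]
  | succ n ih =>
    have hsucc : mechanicalPrefix s t (n + 1)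
        = mechanicalPrefix s t n ++ [mechanicalLetter s t n] := by
      simp [mechanicalPrefix, List.range_succ]
    have hlt := Nat.mod_lt (t * n) h
    have hdm := Nat.div_add_mod (t * n) (s + t)
    have hletter : mechanicalLetter s t n = if s ≤ (t * n) % (s + t) then .b else .a := by
      rw [mechanicalLetter]
      congr 1
      rw [← Nat.cast_mul, ← Int.natCast_mod, Nat.cast_le]
    rw [hsucc, List.count_append, List.count_append, hletter]
    generalize (t * n) % (s + t) = x at *
    generalize t * n / (s + t) = y at *
    split_ifs with hs
    · have h1 : t * (n + 1) / (s + t) = y + 1 := by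
        rw [show t * (n + 1) = x - s + (s + t) * (y + 1) by
          have : x - s + s = x := Nat.sub_add_cancel hs
          linarith, Nat.add_mul_div_left _ _ h, Nat.div_eq_of_lt (by omega)]
        omega
      rw [h1]
      refine ⟨by simp [ih.1], ?_⟩
      have : List.count AB.a [AB.b] = 0 := by decide
      omega
    · have h1 : t * (n + 1) / (s + t) = y := by
        rw [show t * (n + 1) = x + t + (s + t) * y by linarith, Nat.add_mul_div_left _ _ h,
          Nat.div_eq_of_lt (by omega)]
        omega
      rw [h1]
      have h2 : List.count AB.b [AB.a] = 0 := by decide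
      have h3 : List.count AB.a [AB.a] = 1 := by decide
      omega

/-- After n steps the path has height ⌊tn/(s + t)⌋, the largest keeping it below the segment. -/
theorem isLowerChristoffel_mechanicalPrefix {s t : ℕ} (hs : 0 < s) :
    IsLowerChristoffel s t (mechanicalPrefix s t (s + t)) := by
  have hq : 0 < s + t := by omega
  obtain ⟨hb, ha⟩ := count_mechanicalPrefix s t (s + t) hq
  rw [Nat.mul_div_cancel _ hq] at hb ha
  refine ⟨by omega, hb, fun i hi => ?_, fun x y hx hxy => ?_⟩
  · rw [length_mechanicalPrefix] at hi
    rw [take_mechanicalPrefix s t hi]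
    obtain ⟨hb, ha⟩ := count_mechanicalPrefix s t i hq
    rw [hb]
    have h1 := Nat.mul_div_le (t * i) (s + t)
    generalize t * i / (s + t) = y at *
    generalize List.count AB.a (mechanicalPrefix s t i) = x at *
    rw [← ha] at h1
    nlinarith
  · have h1 := Nat.mul_div_le (t * x) s
    have h2 := Nat.lt_mul_div_succ (t * x) hs
    have h3 : y ≤ t * x / s := (Nat.le_div_iff_mul_le hs).2 hxy.le
    have h4 : t * x / s ≤ t := by
      rw [Nat.div_le_iff_le_mul_add_pred hs]
      nlinarith
    generalize t * x / s = h at *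
    have hi : x + h ≤ s + t := by omega
    obtain ⟨hb, ha⟩ := count_mechanicalPrefix s t (x + h) hq
    -- The highest lattice point of abscissa x not above the segment has height h = ⌊tx/s⌋, and it
    -- is the vertex with index x + h.
    have h5 : t * (x + h) / (s + t) = h := by
      rw [Nat.div_eq_iff hq]
      constructor
      · nlinarith
      · have : t * (x + h) < h * (s + t) + (s + t) := by nlinarith
        omega
    refine ⟨x + h, by rwa [length_mechanicalPrefix], ?_⟩
    rw [take_mechanicalPrefix s t hi, hb]
    rw [h5] at ha ⊢
    exact ⟨by omega, h3⟩

theorem isChristoffel_mechanicalPrefix {s t : ℕ} (h : Nat.Coprime s t) :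
    IsChristoffel (mechanicalPrefix s t (s + t)) := by
  rcases Nat.eq_zero_or_pos s with rfl | hs
  · obtain rfl : t = 1 := by simpa using h
    exact Or.inr (Or.inl (by simp [mechanicalPrefix, mechanicalLetter, List.range_succ]))
  rcases Nat.eq_zero_or_pos t with rfl | ht
  · obtain rfl : s = 1 := by simpa using h
    exact Or.inl (by simp [mechanicalPrefix, mechanicalLetter, List.range_succ])
  · exact Or.inr (Or.inr ⟨s, t, hs, ht, h, isLowerChristoffel_mechanicalPrefix hs⟩)

theorem mechanicalLetter_emod (s t : ℕ) (i : ℤ) :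
    mechanicalLetter s t (i % (s + t : ℕ)) = mechanicalLetter s t i := by
  rw [mechanicalLetter, mechanicalLetter, Int.mul_emod, Int.emod_emod_of_dvd _ dvd_rfl,
    ← Int.mul_emod]

theorem power_mechanicalPrefix {s t : ℕ} (h : 0 < s + t) (n : ℕ) :
    power (mechanicalPrefix s t (s + t)) n = mechanicalLetter s t n := by
  have hlt := Nat.mod_lt n h
  rw [power, length_mechanicalPrefix, List.getD_eq_getElem _ _ (by
    rwa [length_mechanicalPrefix]), ← mechanicalLetter_emod]
  simp [mechanicalPrefix]

theorem power_reverse_mechanicalPrefix {s t : ℕ} (h : 0 < s + t) (n : ℕ) :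
    power (mechanicalPrefix s t (s + t)).reverse n = mechanicalLetter s t (-1 - n) := by
  have hlt := Nat.mod_lt n h
  have hdm := Nat.div_add_mod n (s + t)
  rw [power, List.length_reverse, length_mechanicalPrefix, List.getD_eq_getElem _ _ (by
    rwa [List.length_reverse, length_mechanicalPrefix]), List.getElem_reverse,
    ← mechanicalLetter_emod]
  have e : (-1 - (n : ℤ)) % (s + t : ℕ) = ((s + t - 1 - n % (s + t) : ℕ) : ℤ) := by
    rw [Nat.cast_sub (by omega), Nat.cast_sub (by omega), ← Int.emod_eq_of_lt
      (a := ((s + t : ℕ) : ℤ) - (1 : ℕ) - ((n % (s + t) : ℕ) : ℤ)) (b := (s + t : ℕ))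
      (by omega) (by omega)]
    refine Int.emod_eq_emod_iff_emod_sub_eq_zero.mpr (Int.emod_eq_zero_of_dvd
      ⟨-((n / (s + t) : ℕ) : ℤ) - 1, ?_⟩)
    have : ((n : ℕ) : ℤ) = (s + t : ℕ) * ((n / (s + t) : ℕ) : ℤ) + ((n % (s + t) : ℕ) : ℤ) := by
      exact_mod_cast hdm.symm
    push_cast at this ⊢
    linear_combination -this
  rw [e]
  simp [mechanicalPrefix]

theorem IsMechanical.exists_eq_mechanicalLetter {S : ℤ → AB} (h : IsMechanical S) :
    ∃ (s t : ℕ) (c : ℤ), Nat.Coprime s t ∧ 0 < s + t ∧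
      ∀ n, S (c + n) = mechanicalLetter s t n := by
  obtain ⟨p, q, r, hq, hp, hpq, ⟨u, v, huv⟩, hb⟩ := h
  obtain ⟨t, rfl⟩ := Int.eq_ofNat_of_zero_le hp
  obtain ⟨s, hs⟩ := Int.eq_ofNat_of_zero_le (sub_nonneg.mpr hpq)
  obtain rfl : q = s + t := by omega
  -- With u p + v q = 1, the index −r u has phase p(−r u) + r = r v q, which vanishes modulo q; here
  -- the Christoffel period begins.
  refine ⟨s, t, -r * u, ?_, by omega, fun n => ?_⟩
  · rw [← Nat.isCoprime_iff_coprime]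
    exact ⟨v, u + v, by linear_combination huv⟩
  · have h1 := hb (-r * u + n)
    rw [show (t : ℤ) * (-r * u + n) + r = t * n + (s + t) * (r * v) by
      linear_combination (-r) * huv, Int.add_mul_emod_self_left, add_sub_cancel_right] at h1
    rw [mechanicalLetter, Nat.cast_add]
    split_ifs with h2
    · exact h1.2 h2
    · exact AB.eq_a_of_ne_b (mt h1.1 h2)

theorem IsOrientation.eq_wordB {S : ℤ → AB} {ε : ℤ → Bool} {T : ℤ → Letter} {B : BiWord Letter}
    (h : IsOrientation S ε T) (hT : B.IsSection T) {s t : ℕ} {c : ℤ} (hst : 0 < s + t)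
    (hS : ∀ n, S (c + n) = mechanicalLetter s t n) (hc : ε c = true) :
    B = wordB (mechanicalPrefix s t (s + t)) := by
  have hr : rightOf T c = wordE (mechanicalPrefix s t (s + t)) := by
    rw [h.rightOf_eq hc, wordE]
    congr 1
    funext n
    rw [power_mechanicalPrefix hst, ← hS, rightOf]
  have hl : leftOf T (c - 1) = wordE (mechanicalPrefix s t (s + t)).reverse := by
    rw [h.leftOf_eq (by rwa [sub_add_cancel]), wordE]
    congr 1
    funext n
    rw [power_reverse_mechanicalPrefix hst, ← hS, leftOf]
    congr 1; ring
  rw [wordB, ← hr, ← hl, joinSection_leftOf_rightOf]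
  exact (hT.shift c).symm

/-- An admissible doubly infinite word with finite `λ(B)` and `λ(B^∨)` comes from a Christoffel
word. -/
theorem Admissible.exists_isChristoffel {B : BiWord Letter} (hB : Admissible B) (h1 : lam B < ⊤)
    (h2 : lam B.check < ⊤) :
    ∃ w, IsChristoffel w ∧ (B = wordB w ∨ B.check = wordB w) := by
  obtain ⟨T, hT⟩ := B.exists_isSection
  have hadm := hB.biAdm hT
  obtain ⟨S, ε, h⟩ := hadm.exists_isOrientation
  obtain ⟨m, hm⟩ := ENat.ne_top_iff_exists.mp h1.ne
  obtain ⟨n, hn⟩ := ENat.ne_top_iff_exists.mp h2.ne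
  have hbound : MarkoffBound (m + n + 1) S := by
    refine markoffBound_of_lam_lt hT h ?_ ?_
    · rw [← hm]; exact_mod_cast (by omega : m < m + n + 1)
    · rw [← hn]; exact_mod_cast (by omega : n < m + n + 1)
  obtain ⟨s, t, c, hco, hst, hS⟩ :=
    ((hadm.markoff h).isMechanical hbound).exists_eq_mechanicalLetter
  refine ⟨_, isChristoffel_mechanicalPrefix hco, ?_⟩
  -- The orientation at the base point decides between B and B^∨.
  cases hc : ε c
  · exact Or.inr (h.check.eq_wordB hT.check hst hS (by simp [hc]))
  · exact Or.inl (h.eq_wordB hT hst hS hc)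

end Romik

theorem theorem3 (B : Romik.BiWord Romik.Letter) (hB : Romik.Admissible B) :
    ((Romik.lam B = ⊤ ∨ Romik.lam B.check = ⊤) → Romik.lagrange B = 2) ∧
    ((Romik.lam B < ⊤ ∧ Romik.lam B.check < ⊤) →
      ∃ w : List Romik.AB, Romik.IsChristoffel w ∧
        (B = Romik.wordB w ∨ B.check = Romik.wordB w)) := by
  refine ⟨fun h => le_antisymm hB ?_, fun h => hB.exists_isChristoffel h.1 h.2⟩
  rcases h with h | h
  · exact Romik.two_le_lagrange h
  · rw [← Romik.lagrange_check]
    exact Romik.two_le_lagrange h
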